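/- **Consistency of the leave-one-out cross validation estimator for transformed Gaussian processes.** *Notation.* Let $d\ge 1$, $p\ge 1$. On $\mathbb{R}^d$, $|s|=\max_i|s_i|$; $\|\cdot\|$ is the Euclidean norm on the parameter space. A function $k:\mathbb{R}^d\to\mathbb{R}$ is a stationary covariance function if $(k(x_i-x_j))_{i,j\le n}$ is symmetric positive semidefinite for all $n$ and $x_1,\dots,x_n\in\mathbb{R}^d$, and a stationary correlation function if moreover $k(0)=1$. A sequence $(x_i)_{i\ge1}$ in $\mathbb{R}^d$ is well separated if $\inf_{i\ne j}|x_i-x_j|>0$. The Fourier transform is $\hat k(f)=(2\pi)^{-d}\int_{\mathbb{R}^d}k(t)e^{-\mathrm{i}f^\top t}\,dt$. For a square matrix $M$, $\mathrm{diag}(M)$ is $M$ with its off-diagonal elements set to zero. *Random field and observations.* Let $Z$ be a zero-mean Gaussian process on $\mathbb{R}^d$ with stationary covariance function $k_Z$ such that (i) $|k_Z(s)|\le C e^{-c|s|}$ for all $s$, for some constants $C<\infty$, $c>0$, and (ii) for every well separated sequence $(x_i)$, the smallest eigenvalue of $(k_Z(x_i-x_j))_{i,j\le n}$ is bounded below by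 a positive constant that does not depend on $n$. Let $T:\mathbb{R}\to\mathbb{R}$ be non-constant, continuously differentiable and non-decreasing, with $|T(t)|\le Ce^{C|t|}$ and $|T'(t)|\le Ce^{C|t|}$ for all $t$, for some constant $C<\infty$. Let $Y(s)=T(Z(s))$, assume that $Y$ has zero mean, and let $k_Y$ be its stationary covariance function. Let $(s_i)_{i\ge1}$ be a well separated sequence of observation locations and, for $n\ge1$, let $y=(Y(s_1),\dots,Y(s_n))^\top$. *Model.* Let $0<\sigma_{\inf}^2<\sigma_{\sup}^2<\infty$, let $\mathcal{S}\subset\mathbb{R}^{p-1}$ be compact and $\Theta=[\sigma_{\inf}^2,\sigma_{\sup}^2]\times\mathcal{S}$. For $\theta=(\sigma^2,\psi)\in\Theta$ let $k_{Y,\theta}=\sigma^2c_{Y,\psi}$, where $c_{Y,\psi}$ is a stationary correlation function. Assume that at least one of the following holds: (R1) for every $\varepsilon>0$ there is $\delta>0$ such that any two points of $\mathcal{S}$ at distance less than $\delta$ are joined by a curve of length at most $\varepsilon$ contained in $\mathcal{S}$ (for instance, $\mathcal{S}$ is convex, or a finite union of pairwise disjoint compact convex sets); (R2) $c_{Y,\psi}$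 is continuous on $\mathbb{R}^d$ for every $\psi\in\mathcal{S}$. Assume further: 1. For every $s\in\mathbb{R}^d$, $\theta\mapsto k_{Y,\theta}(s)$ is three times continuously differentiable in a neighborhood of each point of $\Theta$; and there are constants $C<\infty$, $c>0$ such that, for all $s\in\mathbb{R}^d$, $\sup_{\theta\in\Theta}|k_{Y,\theta}(s)|\le Ce^{-c|s|}$ and $$\sup_{\theta\in\Theta}\ \max_{\ell=1,2,3}\ \max_{1\le i_1,\dots,i_\ell\le p}\left|\frac{\partial^\ell k_{Y,\theta}(s)}{\partial\theta_{i_1}\cdots\partial\theta_{i_\ell}}\right|\le\frac{C}{1+|s|^{d+c}} .$$ 2. $(\theta,f)\mapsto\hat k_{Y,\theta}(f)$ is jointly continuous and strictly positive on $\Theta\times\mathbb{R}^d$. 3. There is $\theta_0=(\sigma_0^2,\psi_0)$ in the interior of $\Theta$ such that $k_Y=k_{Y,\theta_0}$. 4. (Global identifiability for cross validation.) For all $\alpha>0$, $$\liminf_{n\to\infty}\ \inf_{\psi\in\mathcal{S},\ \|\psi-\psi_0\|\ge\alpha}\ \frac1n\sum_{i,j=1}^n\bigl(c_{Y,\psi}(s_i-s_j)-c_{Y,\psi_0}(s_i-s_j)\bigr)^2>0,$$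 where the infimum over the empty set is $+\infty$. *Estimator.* For $\psi\in\mathcal{S}$ and $n\ge1$ let $C_\psi=(c_{Y,\psi}(s_i-s_j))_{i,j\le n}$ and $$CV_\psi=\frac1n\,y^\top C_\psi^{-1}\,\mathrm{diag}(C_\psi^{-1})^{-2}\,C_\psi^{-1}y,$$ and let $\hat\psi_{\mathrm{CV}}$ be any element of $\operatorname{argmin}_{\psi\in\mathcal{S}}CV_\psi$ (chosen almost surely for each $n$). *Conclusion.* As $n\to\infty$, $\hat\psi_{\mathrm{CV}}$ converges in probability to $\psi_0$. -/

import Mathlib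

open MeasureTheory ProbabilityTheory Filter Topology Matrix

namespace TransformedGP

/-- Locations in `ℝ^d`. The norm of `Fin d → ℝ` is the maximum norm. -/
abbrev Loc (d : ℕ) := Fin d → ℝ

/-- A sequence of locations is asymptotically well separated if the infimum of the distances
between distinct members is positive. -/
def WellSeparated {d : ℕ} (x : ℕ → Loc d) : Prop :=
  ∃ δ : ℝ, 0 < δ ∧ ∀ i j : ℕ, i ≠ j → δ ≤ ‖x i - x j‖

/-- The matrix `(k (x i - x j))`, `i, j < n`. -/
def covMatrix {d : ℕ} (k : Loc d → ℝ) (x : ℕ → Loc d) (n : ℕ) : Matrix (Fin n) (Fin n) ℝ :=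
  Matrix.of fun i j => k (x i - x j)

/-- `k` is a stationary covariance function: `(s, t) ↦ k (s - t)` is symmetric and positive
semidefinite. -/
def IsStationaryCovarianceFunction {d : ℕ} (k : Loc d → ℝ) : Prop :=
  ∀ (n : ℕ) (x : Fin n → Loc d),
    (Matrix.of fun i j => k (x i - x j) : Matrix (Fin n) (Fin n) ℝ).PosSemidef

/-- `k` is a stationary correlation function. -/
def IsStationaryCorrelationFunction {d : ℕ} (k : Loc d → ℝ) : Prop :=
  IsStationaryCovarianceFunction k ∧ k 0 = 1

/-- A stationary covariance function is sub-exponential and asymptotically positive: it decays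
exponentially, and for every well separated sequence of locations the smallest eigenvalues of the
covariance matrices are bounded away from zero. -/
def SubExpAsympPos {d : ℕ} (k : Loc d → ℝ) : Prop :=
  (∃ C c : ℝ, 0 < c ∧ ∀ s, |k s| ≤ C * Real.exp (-c * ‖s‖)) ∧
  ∀ x : ℕ → Loc d, WellSeparated x →
    ∃ b : ℝ, 0 < b ∧ ∀ n : ℕ, ∀ ev ∈ spectrum ℝ (covMatrix k x n), b ≤ ev

/-- A non-constant continuously differentiable transformation that is sub-exponential, with
sub-exponential derivative, and non-decreasing. -/
def SubExpNondecreasing (F : ℝ → ℝ) : Prop :=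
  ContDiff ℝ 1 F ∧ (¬ ∃ a, ∀ t, F t = a) ∧
  (∃ C : ℝ, ∀ t, |F t| ≤ C * Real.exp (C * |t|) ∧ |deriv F t| ≤ C * Real.exp (C * |t|)) ∧
  Monotone F

/-- The random field `X` has zero mean and stationary covariance function `k`. -/
def HasZeroMeanAndCovariance {d : ℕ} {Ω : Type*} [MeasurableSpace Ω] (P : Measure Ω)
    (X : Loc d → Ω → ℝ) (k : Loc d → ℝ) : Prop :=
  (∀ s, ∫ ω, X s ω ∂P = 0) ∧
  ∀ s t, covariance (X s) (X t) P = k (s - t)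

/-- The Fourier transform `(2π)^{-d} ∫ h(t) exp(-i f·t) dt`. -/
noncomputable def fourierTransform {d : ℕ} (h : Loc d → ℝ) (f : Loc d) : ℂ :=
  (((2 * Real.pi) ^ d)⁻¹ : ℝ) *
    ∫ t : Loc d, (h t : ℂ) * Complex.exp (-Complex.I * ((f ⬝ᵥ t : ℝ) : ℂ))

/-- Regularity of a parametric family on `Θ`: for each fixed `s`, `θ ↦ k θ s` is `C³` at all points
of `Θ`, the family decays exponentially, and the partial derivatives of orders 1, 2, 3 decay
polynomially with exponent larger than `d`, all uniformly on `Θ`. -/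
def SmoothFamily {d p : ℕ} (Θ : Set (EuclideanSpace ℝ (Fin p)))
    (k : EuclideanSpace ℝ (Fin p) → Loc d → ℝ) : Prop :=
  (∀ s, ∀ θ ∈ Θ, ContDiffAt ℝ 3 (fun η => k η s) θ) ∧
  (∃ C c : ℝ, 0 < c ∧ ∀ θ ∈ Θ, ∀ s, |k θ s| ≤ C * Real.exp (-c * ‖s‖)) ∧
  (∃ C c : ℝ, 0 < c ∧ ∀ θ ∈ Θ, ∀ s, ∀ l : ℕ, 1 ≤ l → l ≤ 3 → ∀ i : Fin l → Fin p,
    |iteratedFDeriv ℝ l (fun η => k η s) θ (fun j => EuclideanSpace.single (i j) 1)|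
      ≤ C / (1 + ‖s‖ ^ ((d : ℝ) + c)))

/-- The Fourier transforms are jointly continuous and strictly positive on `Θ × ℝ^d`. -/
def PositiveFourierFamily {d p : ℕ} (Θ : Set (EuclideanSpace ℝ (Fin p)))
    (k : EuclideanSpace ℝ (Fin p) → Loc d → ℝ) : Prop :=
  ContinuousOn (fun q : EuclideanSpace ℝ (Fin p) × Loc d => fourierTransform (k q.1) q.2)
    (Θ ×ˢ Set.univ) ∧
  ∀ θ ∈ Θ, ∀ f : Loc d, (fourierTransform (k θ) f).im = 0 ∧ 0 < (fourierTransform (k θ) f).re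

/-- The component `ψ` of a parameter `θ = (σ², ψ)`; the component `σ²` is `θ 0`. -/
def corrPart {q : ℕ} (θ : EuclideanSpace ℝ (Fin (q + 1))) : EuclideanSpace ℝ (Fin q) :=
  WithLp.toLp 2 fun i => θ i.succ

/-- The parameter set `[a, b] × S`. -/
def paramSet {q : ℕ} (a b : ℝ) (S : Set (EuclideanSpace ℝ (Fin q))) :
    Set (EuclideanSpace ℝ (Fin (q + 1))) :=
  {θ | θ 0 ∈ Set.Icc a b ∧ corrPart θ ∈ S}

/-- The covariance model `k_θ = σ² c_ψ` for `θ = (σ², ψ)`. -/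
def covFamily {d q : ℕ} (c : EuclideanSpace ℝ (Fin q) → Loc d → ℝ) :
    EuclideanSpace ℝ (Fin (q + 1)) → Loc d → ℝ :=
  fun θ s => θ 0 * c (corrPart θ) s

/-- Points of `S` that are close to each other can be joined inside `S` by a short
rectifiable curve, uniformly on `S`. Every convex set, and every finite union of pairwise disjoint
compact convex sets, has this property. -/
def HasShortPaths {q : ℕ} (S : Set (EuclideanSpace ℝ (Fin q))) : Prop :=
  ∀ ε : ℝ, 0 < ε → ∃ δ : ℝ, 0 < δ ∧ ∀ x ∈ S, ∀ y ∈ S, ‖x - y‖ < δ →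
    ∃ γ : ℝ → EuclideanSpace ℝ (Fin q), γ 0 = x ∧ γ 1 = y ∧
      (∀ t ∈ Set.Icc (0 : ℝ) 1, γ t ∈ S) ∧
      ∀ t ∈ Set.Icc (0 : ℝ) 1, ∀ u ∈ Set.Icc (0 : ℝ) 1, ‖γ t - γ u‖ ≤ ε * |t - u|

/-- Global identifiability of the correlation model at `ψ₀`. Values are taken in `[0, ∞]`, so that
the infimum over an empty set is `∞`. -/
def GloballyIdentifiable {d q : ℕ} (S : Set (EuclideanSpace ℝ (Fin q)))
    (c : EuclideanSpace ℝ (Fin q) → Loc d → ℝ) (x : ℕ → Loc d)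
    (ψ₀ : EuclideanSpace ℝ (Fin q)) : Prop :=
  ∀ α : ℝ, 0 < α →
    0 < liminf (fun n : ℕ => ⨅ ψ ∈ {ψ ∈ S | α ≤ ‖ψ - ψ₀‖},
      ENNReal.ofReal ((1 / (n : ℝ)) *
        ∑ i : Fin n, ∑ j : Fin n, (c ψ (x i - x j) - c ψ₀ (x i - x j)) ^ 2)) atTop

/-- The matrix obtained by setting the off-diagonal elements to zero. -/
def diagPart {n : ℕ} (M : Matrix (Fin n) (Fin n) ℝ) : Matrix (Fin n) (Fin n) ℝ :=
  Matrix.diagonal fun i => M i i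

/-- The leave-one-out cross validation criterion
`(1/n) yᵀ C⁻¹ diag(C⁻¹)⁻² C⁻¹ y` with `C = (k (x i - x j))`. -/
noncomputable def cvCriterion {d : ℕ} (k : Loc d → ℝ) (x : ℕ → Loc d) (n : ℕ)
    (y : Fin n → ℝ) : ℝ :=
  (1 / (n : ℝ)) *
    (y ⬝ᵥ (((covMatrix k x n)⁻¹ * ((diagPart ((covMatrix k x n)⁻¹))⁻¹) ^ 2 *
      (covMatrix k x n)⁻¹) *ᵥ y))

end TransformedGP

/-!
The criterion at `ψ` is `(1/n) yᵀ A y`, where `A = cvMat C` and `C` is the correlation matrix at `ψ`.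
As `A = Wᵀ W`, where `W = looMat C` maps the observations to their leave-one-out prediction errors,
the expectation of the criterion is a mean squared prediction error. It is compared at `ψ` and at
the true parameter `ψ₀`, and the random fluctuations are shown to be uniformly negligible.

*The gap of the expectations.* Each `looMat C` has unit diagonal, and `looMat C₀ * C₀` is diagonal.
Hence the cross terms vanish in `tr (W C₀ Wᵀ) - tr (W₀ C₀ W₀ᵀ)`, which is therefore bounded below
by the squared Frobenius norm of `W - W₀` (`trace_cvMat_sub_ge`). Since `C` has unit diagonal, it is
a Lipschitz function of `W` in Frobenius norm (`exists_frobSq_sub_le`), and so the global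
identifiability of the correlation model bounds the gap from below
(`exists_trace_cvMat_gap`).

*Uniform conditioning.* These estimates need bounds on the eigenvalues of the correlation matrices
that depend neither on `n` nor on `ψ`. The upper bound follows from the exponential decay. For the
lower bound, the quadratic form of a stationary covariance function `k` is averaged over shifts of
its argument with a narrow Gaussian weight. The average is at most the quadratic form itself, and by
Fubini's theorem it is the integral over frequencies `f` of a wide Gaussian times the transform of
`k` times `|∑ vᵢ exp(i f·xᵢ)|²`. Without the transform of `k`, this integral would be comparable to
`∑ vᵢ²`, because the locations are separated; frequencies outside of a large ball contribute little
to it, and on the ball the transform has a positive minimum, uniformly on the compact parameter set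
(`exists_lower_bound`). Fourier inversion is not used, so that correlation functions may be
discontinuous at zero.

*Continuity in the parameter.* The criterion matrix is continuous in `ψ` in operator norm, uniformly
in `n`, as soon as `c ψ s` is continuous in `ψ` uniformly in `s`. Under the short path condition
this comes from the mean value inequality along a path
(`exists_abs_sub_le_of_shortPaths`); for continuous correlation functions, from positive
definiteness, by which such a function is close to its averages over small balls
(`exists_abs_sub_le_of_continuous`). Compactness then yields a finite net of
parameters (`exists_finset_norm_cvMat_sub_le`).

*Concentration.* For matrices of bounded operator norm, a quadratic form in the transformed Gaussian
vector deviates from its mean by `o(n)` in `L¹` (`exists_quadForm_concentration`). A bounded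
transformation with bounded derivative is treated by a Gaussian Poincaré inequality, obtained from
the rotation argument of Maurey and Pisier (`integral_prod_sub_sq_le`), which gives a variance of
order `n`; the general case follows by approximating the transformation in mean square.

On the event that the estimator is at distance at least `α` from `ψ₀`, the gap forces the
fluctuations on the net and the discretization error to add up to a multiple of `n`
(`gap_le_of_net`), and Markov's inequality bounds its probability.
-/

namespace TransformedGP

/-! ### Operator norm and Frobenius norm of real square matrices -/

section MatrixNorms

open scoped Matrix.Norms.L2Operator

variable {n : ℕ}

theorem norm_toLp_sq (v : Fin n → ℝ) : ‖WithLp.toLp 2 v‖ ^ 2 = v ⬝ᵥ v := by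
  rw [EuclideanSpace.real_norm_sq_eq]
  simp [dotProduct, sq]

theorem dotProduct_self_nonneg' (v : Fin n → ℝ) : 0 ≤ v ⬝ᵥ v := by
  rw [← norm_toLp_sq]; positivity

theorem mulVec_dotProduct_mulVec_le (M : Matrix (Fin n) (Fin n) ℝ) (v : Fin n → ℝ) :
    (M *ᵥ v) ⬝ᵥ (M *ᵥ v) ≤ ‖M‖ ^ 2 * (v ⬝ᵥ v) := by
  have h := M.l2_opNorm_mulVec (WithLp.toLp 2 v)
  rw [← norm_toLp_sq, ← norm_toLp_sq, ← mul_pow]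
  exact pow_le_pow_left₀ (norm_nonneg _) h 2

theorem norm_le_of_mulVec_dotProduct_le {M : Matrix (Fin n) (Fin n) ℝ} {K : ℝ} (hK : 0 ≤ K)
    (h : ∀ v, (M *ᵥ v) ⬝ᵥ (M *ᵥ v) ≤ K ^ 2 * (v ⬝ᵥ v)) : ‖M‖ ≤ K := by
  rw [← l2_opNorm_toEuclideanCLM]
  refine ContinuousLinearMap.opNorm_le_bound _ hK fun v => ?_
  have := h v.ofLp
  rw [← norm_toLp_sq, ← norm_toLp_sq, ← mul_pow] at this
  exact le_of_sq_le_sq this (by positivity)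

theorem two_mul_dotProduct_le (v w : Fin n → ℝ) {t : ℝ} (ht : 0 < t) :
    2 * (v ⬝ᵥ w) ≤ t * (v ⬝ᵥ v) + (w ⬝ᵥ w) / t := by
  simp only [dotProduct, Finset.mul_sum, Finset.sum_div, ← Finset.sum_add_distrib]
  refine Finset.sum_le_sum fun i _ => ?_
  have : 0 ≤ (t * v i - w i) ^ 2 / t := by positivity
  have e : (t * v i - w i) ^ 2 / t = t * (v i * v i) + w i * w i / t - 2 * (v i * w i) := by
    field_simp
    ring
  linarith

theorem abs_dotProduct_mulVec_le (M : Matrix (Fin n) (Fin n) ℝ) (v : Fin n → ℝ) :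
    |v ⬝ᵥ (M *ᵥ v)| ≤ ‖M‖ * (v ⬝ᵥ v) := by
  have h := abs_real_inner_le_norm (WithLp.toLp 2 v) (WithLp.toLp 2 (M *ᵥ v))
  have h2 := M.l2_opNorm_mulVec (WithLp.toLp 2 v)
  have e : inner ℝ (WithLp.toLp 2 v) (WithLp.toLp 2 (M *ᵥ v)) = v ⬝ᵥ (M *ᵥ v) := by
    simp [PiLp.inner_apply, dotProduct, mul_comm]
  rw [e] at h
  calc _ ≤ _ := h
    _ ≤ ‖WithLp.toLp 2 v‖ * (‖M‖ * ‖WithLp.toLp 2 v‖) := by gcongr; exact h2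
    _ = _ := by rw [← norm_toLp_sq]; ring

theorem norm_transpose (M : Matrix (Fin n) (Fin n) ℝ) : ‖Mᵀ‖ = ‖M‖ := by
  rw [← l2_opNorm_conjTranspose M, conjTranspose_eq_transpose_of_trivial]

theorem abs_diag_entry_le (M : Matrix (Fin n) (Fin n) ℝ) (i : Fin n) : |M i i| ≤ ‖M‖ := by
  have h := abs_dotProduct_mulVec_le M (Pi.single i 1)
  simpa using h

theorem norm_diagPart_le (M : Matrix (Fin n) (Fin n) ℝ) : ‖diagPart M‖ ≤ ‖M‖ := by
  rw [diagPart, l2_opNorm_diagonal]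
  exact (pi_norm_le_iff_of_nonneg (norm_nonneg _)).2 fun i => abs_diag_entry_le M i

theorem diagPart_sub (M N : Matrix (Fin n) (Fin n) ℝ) :
    diagPart (M - N) = diagPart M - diagPart N := by
  simp [diagPart, diagonal_sub]

/-- A symmetric matrix whose absolute row sums are at most `B` has operator norm at most `B`. -/
theorem norm_le_of_sum_abs_le {M : Matrix (Fin n) (Fin n) ℝ} (hM : M.IsSymm) {B : ℝ} (hB : 0 ≤ B)
    (h : ∀ i, ∑ j, |M i j| ≤ B) : ‖M‖ ≤ B := by
  refine norm_le_of_mulVec_dotProduct_le hB fun v => ?_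
  have h1 : ∀ i, (M *ᵥ v) i ^ 2 ≤ B * ∑ j, |M i j| * v j ^ 2 := by
    intro i
    have h2 : (M *ᵥ v) i ^ 2 ≤ (∑ j, |M i j|) * ∑ j, |M i j| * v j ^ 2 := by
      change (∑ j, M i j * v j) ^ 2 ≤ _
      refine Finset.sum_sq_le_sum_mul_sum_of_sq_le_mul (R := ℝ) _ (fun j _ => abs_nonneg (M i j))
        (fun j _ => mul_nonneg (abs_nonneg (M i j)) (sq_nonneg (v j))) fun j _ => le_of_eq ?_
      rw [mul_pow, ← sq_abs (M i j)]; ring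
    exact h2.trans (mul_le_mul_of_nonneg_right (h i)
      (Finset.sum_nonneg fun _ _ => by positivity))
  calc (M *ᵥ v) ⬝ᵥ (M *ᵥ v) = ∑ i, (M *ᵥ v) i ^ 2 := by simp [dotProduct, sq]
    _ ≤ ∑ i, B * ∑ j, |M i j| * v j ^ 2 := Finset.sum_le_sum fun i _ => h1 i
    _ = B * ∑ j, (∑ i, |M j i|) * v j ^ 2 := by
        rw [← Finset.mul_sum, Finset.sum_comm]
        simp_rw [Finset.sum_mul]
        congr 1
        refine Finset.sum_congr rfl fun j _ => Finset.sum_congr rfl fun i _ => ?_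
        rw [hM.apply]
    _ ≤ B * ∑ j, B * v j ^ 2 := by
        refine mul_le_mul_of_nonneg_left (Finset.sum_le_sum fun j _ => ?_) hB
        exact mul_le_mul_of_nonneg_right (h j) (sq_nonneg _)
    _ = B ^ 2 * (v ⬝ᵥ v) := by
        rw [← Finset.mul_sum]; simp only [dotProduct, sq]; ring

/-- The squared Frobenius norm. -/
def frobSq (M : Matrix (Fin n) (Fin n) ℝ) : ℝ := ∑ i, ∑ j, M i j ^ 2

theorem frobSq_nonneg (M : Matrix (Fin n) (Fin n) ℝ) : 0 ≤ frobSq M :=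
  Finset.sum_nonneg fun _ _ => Finset.sum_nonneg fun _ _ => sq_nonneg _

theorem frobSq_transpose (M : Matrix (Fin n) (Fin n) ℝ) : frobSq Mᵀ = frobSq M :=
  Finset.sum_comm

theorem frobSq_neg (M : Matrix (Fin n) (Fin n) ℝ) : frobSq (-M) = frobSq M := by
  simp [frobSq]

theorem frobSq_mul_le (X Y : Matrix (Fin n) (Fin n) ℝ) :
    frobSq (X * Y) ≤ ‖X‖ ^ 2 * frobSq Y := by
  rw [← frobSq_transpose (X * Y), ← frobSq_transpose Y, frobSq, frobSq, Finset.mul_sum]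
  refine Finset.sum_le_sum fun j _ => ?_
  have h := mulVec_dotProduct_mulVec_le X (Y.col j)
  simpa [dotProduct, sq, mulVec, Matrix.mul_apply] using h

theorem frobSq_mul_le' (X Y : Matrix (Fin n) (Fin n) ℝ) :
    frobSq (X * Y) ≤ ‖Y‖ ^ 2 * frobSq X := by
  rw [← frobSq_transpose (X * Y), transpose_mul, ← norm_transpose Y, ← frobSq_transpose X]
  exact frobSq_mul_le _ _

theorem frobSq_add_le (X Y : Matrix (Fin n) (Fin n) ℝ) :
    frobSq (X + Y) ≤ 2 * frobSq X + 2 * frobSq Y := by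
  simp only [frobSq, Finset.mul_sum, ← Finset.sum_add_distrib]
  refine Finset.sum_le_sum fun i _ => Finset.sum_le_sum fun j _ => ?_
  rw [Matrix.add_apply]
  nlinarith [sq_nonneg (X i j - Y i j)]

theorem frobSq_diagPart_le (X : Matrix (Fin n) (Fin n) ℝ) : frobSq (diagPart X) ≤ frobSq X := by
  refine Finset.sum_le_sum fun i _ => Finset.sum_le_sum fun j _ => ?_
  by_cases h : i = j
  · subst h; simp [diagPart]
  · simp [diagPart, h, sq_nonneg]

end MatrixNorms

/-! ### The matrix of the cross validation criterion -/

section LooMatrix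

open scoped Matrix.Norms.L2Operator

variable {n : ℕ} {l M : ℝ} {C C₀ : Matrix (Fin n) (Fin n) ℝ}

/-- A symmetric matrix whose spectrum lies in `[l, M]`, expressed by the quadratic form and the
operator norm. -/
structure WellConditioned (l M : ℝ) (C : Matrix (Fin n) (Fin n) ℝ) : Prop where
  symm : C.IsSymm
  lower : ∀ v : Fin n → ℝ, l * (v ⬝ᵥ v) ≤ v ⬝ᵥ (C *ᵥ v)
  upper : ‖C‖ ≤ M

/-- The matrix `diag(C⁻¹)⁻¹ C⁻¹`, which maps the observations to their leave-one-out prediction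
errors under the covariance matrix `C`. -/
noncomputable def looMat (C : Matrix (Fin n) (Fin n) ℝ) : Matrix (Fin n) (Fin n) ℝ :=
  (diagPart C⁻¹)⁻¹ * C⁻¹

/-- The matrix `C⁻¹ diag(C⁻¹)⁻² C⁻¹` of the cross validation criterion. -/
noncomputable def cvMat (C : Matrix (Fin n) (Fin n) ℝ) : Matrix (Fin n) (Fin n) ℝ :=
  C⁻¹ * ((diagPart C⁻¹)⁻¹) ^ 2 * C⁻¹

theorem diagPart_transpose (A : Matrix (Fin n) (Fin n) ℝ) : (diagPart A)ᵀ = diagPart A := by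
  simp [diagPart]

theorem cvMat_eq (h : C.IsSymm) : cvMat C = (looMat C)ᵀ * looMat C := by
  rw [cvMat, looMat, transpose_mul, transpose_nonsing_inv, transpose_nonsing_inv,
    diagPart_transpose, h.eq]
  simp only [sq, Matrix.mul_assoc]

theorem cvMat_isSymm (h : C.IsSymm) : (cvMat C).IsSymm := by
  rw [cvMat_eq h]; exact isSymm_transpose_mul_self _

namespace WellConditioned

theorem isUnit_det (h : WellConditioned l M C) (hl : 0 < l) : IsUnit C.det := by
  rw [← Matrix.isUnit_iff_isUnit_det, ← Matrix.mulVec_injective_iff_isUnit]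
  intro v w hvw
  have h1 : C *ᵥ (v - w) = 0 := by rw [mulVec_sub, hvw, sub_self]
  have h2 := h.lower (v - w)
  rw [h1, dotProduct_zero] at h2
  have h3 : (v - w) ⬝ᵥ (v - w) = 0 :=
    le_antisymm (by nlinarith) (dotProduct_self_nonneg' _)
  exact sub_eq_zero.1 (dotProduct_self_eq_zero.1 h3)

theorem mul_inv (h : WellConditioned l M C) (hl : 0 < l) : C * C⁻¹ = 1 :=
  mul_nonsing_inv _ (h.isUnit_det hl)

theorem inv_mul (h : WellConditioned l M C) (hl : 0 < l) : C⁻¹ * C = 1 :=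
  nonsing_inv_mul _ (h.isUnit_det hl)

theorem norm_inv_le (h : WellConditioned l M C) (hl : 0 < l) : ‖C⁻¹‖ ≤ 1 / l := by
  refine norm_le_of_mulVec_dotProduct_le (by positivity) fun v => ?_
  set w := C⁻¹ *ᵥ v with hw
  have h1 : C *ᵥ w = v := by rw [hw, mulVec_mulVec, h.mul_inv hl, one_mulVec]
  have h2 := h.lower w
  rw [h1] at h2
  have h3 := two_mul_dotProduct_le w v hl
  have h4 : l * (w ⬝ᵥ w) ≤ (v ⬝ᵥ v) / l := by linarith
  rw [le_div_iff₀ hl] at h4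
  rw [div_pow, one_pow, one_div, ← div_eq_inv_mul, le_div_iff₀ (by positivity)]
  linarith

/-- The diagonal entries of `C⁻¹` are at least `l / M²`. -/
theorem le_inv_diag (h : WellConditioned l M C) (hl : 0 < l) (hM : 0 < M) (i : Fin n) :
    l / M ^ 2 ≤ C⁻¹ i i := by
  set e : Fin n → ℝ := Pi.single i 1 with he
  set w := C⁻¹ *ᵥ e with hw
  have h1 : C *ᵥ w = e := by rw [hw, mulVec_mulVec, h.mul_inv hl, one_mulVec]
  have h2 := h.lower w
  have h3 := mulVec_dotProduct_mulVec_le C w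
  have h4 : e ⬝ᵥ e = 1 := by simp [he]
  have h5 : w ⬝ᵥ e = C⁻¹ i i := by simp [hw, he]
  rw [h1, h5] at h2
  rw [h1, h4] at h3
  have h6 : ‖C‖ ^ 2 * (w ⬝ᵥ w) ≤ M ^ 2 * (w ⬝ᵥ w) := by
    gcongr
    · exact dotProduct_self_nonneg' w
    · exact h.upper
  rw [div_le_iff₀ (by positivity)]
  have : 0 < M ^ 2 := by positivity
  nlinarith

theorem inv_diag_pos (h : WellConditioned l M C) (hl : 0 < l) (hM : 0 < M) (i : Fin n) :
    0 < C⁻¹ i i :=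
  (by positivity : 0 < l / M ^ 2).trans_le (h.le_inv_diag hl hM i)

theorem diagPart_inv_eq (h : WellConditioned l M C) (hl : 0 < l) (hM : 0 < M) :
    (diagPart C⁻¹)⁻¹ = diagonal fun i => (C⁻¹ i i)⁻¹ := by
  refine inv_eq_right_inv ?_
  rw [diagPart, diagonal_mul_diagonal, ← diagonal_one]
  congr 1
  ext i
  exact mul_inv_cancel₀ (h.inv_diag_pos hl hM i).ne'

theorem diagPart_mul_inv (h : WellConditioned l M C) (hl : 0 < l) (hM : 0 < M) :
    diagPart C⁻¹ * (diagPart C⁻¹)⁻¹ = 1 := by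
  rw [h.diagPart_inv_eq hl hM, diagPart, diagonal_mul_diagonal, ← diagonal_one]
  congr 1
  ext i
  exact mul_inv_cancel₀ (h.inv_diag_pos hl hM i).ne'

theorem inv_mul_diagPart (h : WellConditioned l M C) (hl : 0 < l) (hM : 0 < M) :
    (diagPart C⁻¹)⁻¹ * diagPart C⁻¹ = 1 :=
  mul_eq_one_comm.1 (h.diagPart_mul_inv hl hM)

theorem norm_diagPart_inv_le (h : WellConditioned l M C) (hl : 0 < l) (hM : 0 < M) :
    ‖(diagPart C⁻¹)⁻¹‖ ≤ M ^ 2 / l := by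
  rw [h.diagPart_inv_eq hl hM, l2_opNorm_diagonal]
  refine (pi_norm_le_iff_of_nonneg (by positivity)).2 fun i => ?_
  have h1 := h.inv_diag_pos hl hM i
  rw [Real.norm_of_nonneg (by positivity), inv_le_comm₀ h1 (by positivity), inv_div]
  exact h.le_inv_diag hl hM i

theorem norm_looMat_le (h : WellConditioned l M C) (hl : 0 < l) (hM : 0 < M) :
    ‖looMat C‖ ≤ M ^ 2 / l ^ 2 := by
  calc ‖looMat C‖ ≤ ‖(diagPart C⁻¹)⁻¹‖ * ‖C⁻¹‖ := norm_mul_le _ _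
    _ ≤ (M ^ 2 / l) * (1 / l) := by
        gcongr
        · exact h.norm_diagPart_inv_le hl hM
        · exact h.norm_inv_le hl
    _ = _ := by field_simp

theorem norm_cvMat_le (h : WellConditioned l M C) (hl : 0 < l) (hM : 0 < M) :
    ‖cvMat C‖ ≤ (M ^ 2 / l ^ 2) ^ 2 := by
  rw [cvMat_eq h.symm, sq (M ^ 2 / l ^ 2)]
  refine (norm_mul_le _ _).trans ?_
  rw [norm_transpose]
  have := h.norm_looMat_le hl hM
  gcongr

theorem norm_inv_sub_le (h : WellConditioned l M C) (h₀ : WellConditioned l M C₀) (hl : 0 < l) :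
    ‖C⁻¹ - C₀⁻¹‖ ≤ 1 / l ^ 2 * ‖C - C₀‖ := by
  have e : C⁻¹ - C₀⁻¹ = C⁻¹ * (C₀ - C) * C₀⁻¹ := by
    rw [Matrix.mul_sub, Matrix.sub_mul, Matrix.mul_assoc, h₀.mul_inv hl, h.inv_mul hl]; simp
  rw [e]
  calc _ ≤ ‖C⁻¹‖ * ‖C₀ - C‖ * ‖C₀⁻¹‖ := norm_mul₃_le
    _ ≤ (1 / l) * ‖C₀ - C‖ * (1 / l) := by
        gcongr
        · exact h.norm_inv_le hl
        · exact h₀.norm_inv_le hl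
    _ = _ := by rw [norm_sub_rev]; field_simp

theorem norm_diagPart_inv_sub_le (h : WellConditioned l M C) (h₀ : WellConditioned l M C₀)
    (hl : 0 < l) (hM : 0 < M) :
    ‖(diagPart C⁻¹)⁻¹ - (diagPart C₀⁻¹)⁻¹‖ ≤ (M ^ 2 / l) ^ 2 * (1 / l ^ 2) * ‖C - C₀‖ := by
  have e : (diagPart C⁻¹)⁻¹ - (diagPart C₀⁻¹)⁻¹
      = (diagPart C⁻¹)⁻¹ * diagPart (C₀⁻¹ - C⁻¹) * (diagPart C₀⁻¹)⁻¹ := by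
    rw [diagPart_sub, Matrix.mul_sub, Matrix.sub_mul, Matrix.mul_assoc,
      h₀.diagPart_mul_inv hl hM, h.inv_mul_diagPart hl hM]
    simp
  rw [e]
  calc _ ≤ ‖(diagPart C⁻¹)⁻¹‖ * ‖diagPart (C₀⁻¹ - C⁻¹)‖ * ‖(diagPart C₀⁻¹)⁻¹‖ := norm_mul₃_le
    _ ≤ (M ^ 2 / l) * (1 / l ^ 2 * ‖C₀ - C‖) * (M ^ 2 / l) := by
        gcongr
        · exact h.norm_diagPart_inv_le hl hM
        · exact (norm_diagPart_le _).trans (h₀.norm_inv_sub_le h hl)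
        · exact h₀.norm_diagPart_inv_le hl hM
    _ = _ := by rw [norm_sub_rev]; ring

/-- The leave-one-out matrix is a Lipschitz function of the covariance matrix, with a constant
that does not depend on the dimension. -/
theorem norm_looMat_sub_le (h : WellConditioned l M C) (h₀ : WellConditioned l M C₀)
    (hl : 0 < l) (hM : 0 < M) :
    ‖looMat C - looMat C₀‖ ≤
      ((M ^ 2 / l) ^ 2 * (1 / l ^ 2) * (1 / l) + M ^ 2 / l * (1 / l ^ 2)) * ‖C - C₀‖ := by
  have e : looMat C - looMat C₀ = ((diagPart C⁻¹)⁻¹ - (diagPart C₀⁻¹)⁻¹) * C⁻¹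
      + (diagPart C₀⁻¹)⁻¹ * (C⁻¹ - C₀⁻¹) := by
    rw [looMat, looMat, Matrix.sub_mul, Matrix.mul_sub]; abel
  rw [e, add_mul]
  refine (norm_add_le _ _).trans (add_le_add ?_ ?_)
  · refine (norm_mul_le _ _).trans ?_
    calc _ ≤ ((M ^ 2 / l) ^ 2 * (1 / l ^ 2) * ‖C - C₀‖) * (1 / l) := by
          gcongr
          · exact h.norm_diagPart_inv_sub_le h₀ hl hM
          · exact h.norm_inv_le hl
      _ = _ := by ring
  · refine (norm_mul_le _ _).trans ?_
    calc _ ≤ (M ^ 2 / l) * (1 / l ^ 2 * ‖C - C₀‖) := by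
          gcongr
          · exact h₀.norm_diagPart_inv_le hl hM
          · exact h.norm_inv_sub_le h₀ hl
      _ = _ := by ring

end WellConditioned

/-- The matrix of the cross validation criterion is a Lipschitz function of the covariance matrix,
with a constant that does not depend on the dimension. -/
theorem exists_norm_cvMat_sub_le (hl : 0 < l) (hM : 0 < M) :
    ∃ K : ℝ, 0 < K ∧ ∀ (n : ℕ) (C C₀ : Matrix (Fin n) (Fin n) ℝ), WellConditioned l M C →
      WellConditioned l M C₀ → ‖cvMat C - cvMat C₀‖ ≤ K * ‖C - C₀‖ := by
  set L := (M ^ 2 / l) ^ 2 * (1 / l ^ 2) * (1 / l) + M ^ 2 / l * (1 / l ^ 2) with hL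
  refine ⟨2 * (M ^ 2 / l ^ 2) * L, by positivity, fun n C C₀ h h₀ => ?_⟩
  have e : cvMat C - cvMat C₀ = (looMat C - looMat C₀)ᵀ * looMat C
      + (looMat C₀)ᵀ * (looMat C - looMat C₀) := by
    rw [cvMat_eq h.symm, cvMat_eq h₀.symm, transpose_sub, Matrix.sub_mul, Matrix.mul_sub]; abel
  have h1 := h.norm_looMat_sub_le h₀ hl hM
  have h2 := h.norm_looMat_le hl hM
  have h3 := h₀.norm_looMat_le hl hM
  rw [← hL] at h1
  rw [e]
  calc _ ≤ ‖(looMat C - looMat C₀)ᵀ‖ * ‖looMat C‖ + ‖(looMat C₀)ᵀ‖ * ‖looMat C - looMat C₀‖ :=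
        (norm_add_le _ _).trans (add_le_add (norm_mul_le _ _) (norm_mul_le _ _))
    _ ≤ (L * ‖C - C₀‖) * (M ^ 2 / l ^ 2) + (M ^ 2 / l ^ 2) * (L * ‖C - C₀‖) := by
        rw [norm_transpose, norm_transpose]
        gcongr
    _ = _ := by ring

/-- The mean squared prediction error exceeds its minimum by a quadratic form in the difference of
the leave-one-out matrices: the difference has zero diagonal, and `looMat C₀ * C₀` is diagonal, so
that the cross terms vanish. -/
theorem trace_cvMat_sub_ge (h : WellConditioned l M C) (h₀ : WellConditioned l M C₀)
    (hl : 0 < l) (hM : 0 < M) :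
    l * frobSq (looMat C - looMat C₀) ≤ (cvMat C * C₀).trace - (cvMat C₀ * C₀).trace := by
  set V := looMat C - looMat C₀ with hV
  have hdiag : ∀ i, V i i = 0 := by
    intro i
    have key : ∀ {B : Matrix (Fin n) (Fin n) ℝ}, WellConditioned l M B → looMat B i i = 1 := by
      intro B hB
      rw [looMat, hB.diagPart_inv_eq hl hM, diagonal_mul]
      exact inv_mul_cancel₀ (hB.inv_diag_pos hl hM i).ne'
    rw [hV, Matrix.sub_apply, key h, key h₀, sub_self]
  have hW₀ : looMat C₀ * C₀ = (diagPart C₀⁻¹)⁻¹ := by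
    rw [looMat, Matrix.mul_assoc, h₀.inv_mul hl, Matrix.mul_one]
  have hD : ((diagPart C₀⁻¹)⁻¹)ᵀ = (diagPart C₀⁻¹)⁻¹ := by
    rw [transpose_nonsing_inv, diagPart_transpose]
  have hcross : (Vᵀ * (diagPart C₀⁻¹)⁻¹).trace = 0 := by
    rw [h₀.diagPart_inv_eq hl hM, trace]
    refine Finset.sum_eq_zero fun i _ => ?_
    rw [diag_apply, mul_diagonal, transpose_apply, hdiag, zero_mul]
  have hcross' : ((looMat C₀)ᵀ * V * C₀).trace = 0 := by
    have : C₀ * (looMat C₀)ᵀ = (diagPart C₀⁻¹)⁻¹ := by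
      rw [← hD, ← hW₀, transpose_mul, h₀.symm.eq]
    rw [trace_mul_cycle, this, h₀.diagPart_inv_eq hl hM, trace]
    refine Finset.sum_eq_zero fun i _ => ?_
    rw [diag_apply, diagonal_mul, hdiag, mul_zero]
  have e : (cvMat C * C₀).trace - (cvMat C₀ * C₀).trace = (Vᵀ * V * C₀).trace := by
    have hW : looMat C = looMat C₀ + V := by rw [hV]; abel
    rw [cvMat_eq h.symm, cvMat_eq h₀.symm, hW, transpose_add, Matrix.add_mul, Matrix.mul_add,
      Matrix.mul_add, Matrix.add_mul, Matrix.add_mul, Matrix.add_mul, trace_add, trace_add,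
      trace_add, Matrix.mul_assoc Vᵀ (looMat C₀), hW₀, hcross, hcross']
    ring
  have e2 : (Vᵀ * V * C₀).trace = ∑ i, V i ⬝ᵥ (C₀ *ᵥ V i) := by
    rw [Matrix.mul_assoc, trace_mul_comm, trace]
    refine Finset.sum_congr rfl fun i _ => ?_
    have hs : C₀ *ᵥ V i = V i ᵥ* C₀ := by rw [← mulVec_transpose, h₀.symm.eq]
    rw [hs, diag_apply, mul_apply, dotProduct]
    refine Finset.sum_congr rfl fun j _ => ?_
    rw [transpose_apply, mul_comm]; rfl
  rw [e, e2, frobSq, Finset.mul_sum]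
  refine Finset.sum_le_sum fun i _ => le_trans (le_of_eq ?_) (h₀.lower (V i))
  simp [dotProduct, sq]

/-- A correlation matrix is a Lipschitz function of its leave-one-out matrix, in Frobenius norm.
With `U = (looMat C)⁻¹ = C * diagPart C⁻¹`, the unit diagonal of `C` gives
`diagPart U = diagPart C⁻¹`, so that `C = U * (diagPart U)⁻¹` is recovered from `U`. -/
theorem exists_frobSq_sub_le (hl : 0 < l) (hM : 0 < M) :
    ∃ K : ℝ, 0 < K ∧ ∀ (n : ℕ) (C C₀ : Matrix (Fin n) (Fin n) ℝ), WellConditioned l M C →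
      WellConditioned l M C₀ → (∀ i, C i i = 1) → (∀ i, C₀ i i = 1) →
      frobSq (C - C₀) ≤ K * frobSq (looMat C - looMat C₀) := by
  set R := M ^ 2 / l with hR
  have hRpos : 0 < R := by positivity
  refine ⟨2 * (R ^ 2 + M ^ 2 * R ^ 2) * ((M * (1 / l)) ^ 2) ^ 2, by positivity,
    fun n C C₀ h h₀ h1 h1₀ => ?_⟩
  set D := diagPart C⁻¹ with hD
  set D₀ := diagPart C₀⁻¹ with hD₀
  set U := C * D with hU
  set U₀ := C₀ * D₀ with hU₀
  have hUW : U * looMat C = 1 := by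
    rw [hU, looMat, Matrix.mul_assoc, ← Matrix.mul_assoc D, h.diagPart_mul_inv hl hM,
      Matrix.one_mul, h.mul_inv hl]
  have hWU₀ : looMat C₀ * U₀ = 1 := by
    rw [hU₀, looMat, Matrix.mul_assoc, ← Matrix.mul_assoc C₀⁻¹, h₀.inv_mul hl,
      Matrix.one_mul, h₀.inv_mul_diagPart hl hM]
  have hUU : U - U₀ = -(U * (looMat C - looMat C₀) * U₀) := by
    rw [Matrix.mul_sub, Matrix.sub_mul, hUW, Matrix.mul_assoc, hWU₀]; simp
  have hdU : ∀ {B : Matrix (Fin n) (Fin n) ℝ}, (∀ i, B i i = 1) →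
      diagPart (B * diagPart B⁻¹) = diagPart B⁻¹ := by
    intro B hB
    simp only [diagPart]
    congr 1
    ext i
    rw [mul_diagonal, hB, one_mul]
  have hDD : D₀ - D = -diagPart (U - U₀) := by
    rw [diagPart_sub, hU, hU₀, hdU h1, hdU h1₀]; abel
  have hnU : ∀ {B : Matrix (Fin n) (Fin n) ℝ}, WellConditioned l M B →
      ‖B * diagPart B⁻¹‖ ≤ M * (1 / l) := by
    intro B hB
    refine (norm_mul_le _ _).trans ?_
    have := hB.upper
    have := (norm_diagPart_le B⁻¹).trans (hB.norm_inv_le hl)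
    gcongr
  have hF : frobSq (U - U₀) ≤ ((M * (1 / l)) ^ 2) ^ 2 * frobSq (looMat C - looMat C₀) := by
    have a1 := hnU h
    have a2 := hnU h₀
    rw [hUU, frobSq_neg]
    refine (frobSq_mul_le' _ _).trans ?_
    have b := frobSq_nonneg (looMat C - looMat C₀)
    have c := frobSq_nonneg (U * (looMat C - looMat C₀))
    have a3 : frobSq (U * (looMat C - looMat C₀))
        ≤ (M * (1 / l)) ^ 2 * frobSq (looMat C - looMat C₀) :=
      (frobSq_mul_le _ _).trans (by gcongr)
    refine (mul_le_mul (pow_le_pow_left₀ (norm_nonneg _) a2 2) a3 c (by positivity)).trans ?_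
    exact le_of_eq (by ring)
  have hCC : C - C₀ = (U - U₀) * D⁻¹ + C₀ * ((D₀ - D) * D⁻¹) := by
    have a : U * D⁻¹ = C := by
      rw [hU, Matrix.mul_assoc, h.diagPart_mul_inv hl hM, Matrix.mul_one]
    have b : D * D⁻¹ = 1 := h.diagPart_mul_inv hl hM
    rw [Matrix.sub_mul, a, Matrix.sub_mul, b, Matrix.mul_sub, ← Matrix.mul_assoc, ← hU₀]
    simp
  have nD : ‖D⁻¹‖ ≤ R := h.norm_diagPart_inv_le hl hM
  have f1 : frobSq ((U - U₀) * D⁻¹) ≤ R ^ 2 * frobSq (U - U₀) := by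
    refine (frobSq_mul_le' _ _).trans ?_
    have := frobSq_nonneg (U - U₀)
    gcongr
  have f2 : frobSq (C₀ * ((D₀ - D) * D⁻¹)) ≤ M ^ 2 * R ^ 2 * frobSq (U - U₀) := by
    have a1 := h₀.upper
    refine (frobSq_mul_le _ _).trans ?_
    rw [mul_assoc]
    have := frobSq_nonneg ((D₀ - D) * D⁻¹)
    have a0 := frobSq_nonneg (D₀ - D)
    have a2 : frobSq (D₀ - D) ≤ frobSq (U - U₀) := by
      rw [hDD, frobSq_neg]; exact frobSq_diagPart_le _
    gcongr
    refine (frobSq_mul_le' _ _).trans ?_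
    gcongr
  calc frobSq (C - C₀) ≤ 2 * frobSq ((U - U₀) * D⁻¹) + 2 * frobSq (C₀ * ((D₀ - D) * D⁻¹)) := by
        rw [hCC]; exact frobSq_add_le _ _
    _ ≤ 2 * (R ^ 2 + M ^ 2 * R ^ 2) * frobSq (U - U₀) := by nlinarith
    _ ≤ 2 * (R ^ 2 + M ^ 2 * R ^ 2) *
        (((M * (1 / l)) ^ 2) ^ 2 * frobSq (looMat C - looMat C₀)) := by gcongr
    _ = _ := by ring

end LooMatrix

/-! ### Sums over well separated locations -/

section Packing

variable {d : ℕ}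

theorem integrable_exp_neg_mul_norm {c : ℝ} (hc : 0 < c) :
    Integrable fun t : Loc d => Real.exp (-c * ‖t‖) := by
  have h1 : Integrable fun t : Loc d => (1 + ‖t‖) ^ (-((d + 1 : ℕ) : ℝ)) :=
    integrable_one_add_norm (by simp)
  refine (h1.const_mul (Real.exp c * (d + 1).factorial / c ^ (d + 1))).mono'
    (by fun_prop) (Eventually.of_forall fun t => ?_)
  have h2 := Real.pow_div_factorial_le_exp (c * (1 + ‖t‖)) (by positivity) (d + 1)
  have h3 : 0 < 1 + ‖t‖ := by positivity
  rw [Real.norm_of_nonneg (Real.exp_nonneg _), Real.rpow_neg h3.le, Real.rpow_natCast]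
  rw [div_le_iff₀ (by positivity), mul_pow] at h2
  rw [← div_eq_mul_inv, div_div, le_div_iff₀ (by positivity)]
  have h4 : Real.exp (c * (1 + ‖t‖)) = Real.exp c * Real.exp (c * ‖t‖) := by
    rw [← Real.exp_add]; ring_nf
  have h5 : Real.exp (-c * ‖t‖) * Real.exp (c * ‖t‖) = 1 := by
    rw [← Real.exp_add]; simp
  calc _ ≤ Real.exp (-c * ‖t‖) * (Real.exp (c * (1 + ‖t‖)) * (d + 1).factorial) := by gcongr
    _ = Real.exp c * (d + 1).factorial * (Real.exp (-c * ‖t‖) * Real.exp (c * ‖t‖)) := by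
        rw [h4]; ring
    _ = _ := by rw [h5, mul_one]

/-- Exponentially decaying sums over a well separated sequence are bounded: the terms are
dominated by integrals over disjoint balls around the locations. -/
theorem exists_sum_exp_le {x : ℕ → Loc d} (hx : WellSeparated x) {c : ℝ} (hc : 0 < c) :
    ∃ B : ℝ, 0 < B ∧ ∀ (n : ℕ) (z : Loc d),
      ∑ j : Fin n, Real.exp (-c * ‖z - x j‖) ≤ B := by
  obtain ⟨δ, hδ, hsep⟩ := hx
  set v : ℝ := volume.real (Metric.ball (0 : Loc d) (δ / 2)) with hv
  have hvpos : 0 < v :=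
    ENNReal.toReal_pos (Metric.measure_ball_pos _ _ (by positivity)).ne' measure_ball_lt_top.ne
  set J : ℝ := ∫ t : Loc d, Real.exp (-c * ‖t‖) with hJ
  have hJ0 : 0 ≤ J := integral_nonneg fun t => Real.exp_nonneg _
  refine ⟨Real.exp (c * δ / 2) * J / v + 1, by positivity, fun n z => ?_⟩
  have hint : Integrable fun t : Loc d => Real.exp (-c * ‖z - t‖) :=
    (integrable_exp_neg_mul_norm hc).comp_sub_left z
  have hball : ∀ j : ℕ, v * Real.exp (-c * ‖z - x j‖) ≤
      Real.exp (c * δ / 2) * ∫ t in Metric.ball (x j) (δ / 2), Real.exp (-c * ‖z - t‖) := by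
    intro j
    have e : v = volume.real (Metric.ball (x j) (δ / 2)) := by
      rw [hv, measureReal_def, measureReal_def, Measure.addHaar_ball_center volume (x j)]
    rw [e, ← smul_eq_mul, ← setIntegral_const, ← integral_const_mul]
    refine setIntegral_mono_on (by simp [measure_ball_lt_top])
      (hint.integrableOn.const_mul _) measurableSet_ball fun t ht => ?_
    rw [← Real.exp_add, Real.exp_le_exp]
    rw [mem_ball_iff_norm] at ht
    have : ‖z - t‖ ≤ ‖z - x j‖ + ‖t - x j‖ := by
      have := norm_sub_le (z - x j) (t - x j)
      simpa using this
    nlinarith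
  have hsum : ∑ j : Fin n, ∫ t in Metric.ball (x j) (δ / 2), Real.exp (-c * ‖z - t‖) ≤ J := by
    rw [← integral_biUnion_finset (t := Finset.univ) (s := fun j : Fin n => Metric.ball (x j) (δ / 2))
      (fun _ _ => measurableSet_ball) ?_ (fun _ _ => hint.integrableOn)]
    · calc _ ≤ ∫ t : Loc d, Real.exp (-c * ‖z - t‖) :=
            setIntegral_le_integral hint (Eventually.of_forall fun t => Real.exp_nonneg _)
        _ = J := integral_sub_left_eq_self (fun t : Loc d => Real.exp (-c * ‖t‖)) volume z
    · intro i _ j _ hij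
      refine Metric.ball_disjoint_ball ?_
      rw [add_halves, dist_eq_norm]
      exact hsep i j fun h => hij (Fin.ext h)
  have : v * ∑ j : Fin n, Real.exp (-c * ‖z - x j‖) ≤ Real.exp (c * δ / 2) * J := by
    rw [Finset.mul_sum]
    refine (Finset.sum_le_sum fun (j : Fin n) _ => hball j).trans ?_
    rw [← Finset.mul_sum]
    gcongr
  have h6 : ∑ j : Fin n, Real.exp (-c * ‖z - x j‖) ≤ Real.exp (c * δ / 2) * J / v := by
    rw [le_div_iff₀ hvpos]; linarith
  linarith

open scoped Matrix.Norms.L2Operator in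
/-- The covariance matrix of an exponentially decaying function on well separated locations has
operator norm bounded independently of the number of locations. -/
theorem exists_norm_covMatrix_le {x : ℕ → Loc d} (hx : WellSeparated x) {c : ℝ} (hc : 0 < c) :
    ∃ B : ℝ, 0 < B ∧ ∀ (C : ℝ) (k : Loc d → ℝ), (∀ s, k (-s) = k s) →
      (∀ s, |k s| ≤ C * Real.exp (-c * ‖s‖)) → ∀ n, ‖covMatrix k x n‖ ≤ C * B := by
  obtain ⟨B, hB, hsum⟩ := exists_sum_exp_le hx hc
  refine ⟨B, hB, fun C k hneg hk n => ?_⟩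
  have hC : 0 ≤ C := by
    have := (abs_nonneg _).trans (hk 0)
    simpa using this
  refine norm_le_of_sum_abs_le ?_ (by positivity) fun i => ?_
  · ext i j
    simp only [covMatrix, transpose_apply, of_apply]
    rw [← hneg, neg_sub]
  · calc ∑ j, |covMatrix k x n i j| ≤ ∑ j : Fin n, C * Real.exp (-c * ‖x i - x j‖) :=
          Finset.sum_le_sum fun j _ => hk _
      _ ≤ C * B := by
          rw [← Finset.mul_sum]
          exact mul_le_mul_of_nonneg_left (hsum n (x i)) hC

/-- The squared Euclidean norm on `ℝ^d`; the norm of `Loc d` is the maximum norm. -/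
def sqNorm (u : Loc d) : ℝ := ∑ i, u i ^ 2

theorem sqNorm_nonneg (u : Loc d) : 0 ≤ sqNorm u := Finset.sum_nonneg fun _ _ => sq_nonneg _

theorem norm_sq_le_sqNorm (u : Loc d) : ‖u‖ ^ 2 ≤ sqNorm u := by
  have h : ‖u‖ ≤ √(sqNorm u) := by
    refine (pi_norm_le_iff_of_nonneg (Real.sqrt_nonneg _)).2 fun i => ?_
    refine Real.abs_le_sqrt ?_
    exact Finset.single_le_sum (f := fun i => u i ^ 2) (fun _ _ => sq_nonneg _) (Finset.mem_univ i)
  calc ‖u‖ ^ 2 ≤ √(sqNorm u) ^ 2 := by gcongr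
    _ = _ := Real.sq_sqrt (sqNorm_nonneg u)

@[fun_prop]
theorem continuous_sqNorm : Continuous (sqNorm : Loc d → ℝ) := by
  unfold sqNorm; fun_prop

/-- Narrow Gaussian kernels have diagonally dominant matrices on well separated locations. -/
theorem exists_sum_gaussian_le {x : ℕ → Loc d} (hx : WellSeparated x) :
    ∃ s₀ : ℝ, 0 < s₀ ∧ ∀ s : ℝ, 0 < s → s ≤ s₀ → ∀ (n : ℕ) (i : Fin n),
      ∑ j : Fin n with j ≠ i, Real.exp (-(sqNorm (x i - x j) / (4 * s))) ≤ 1 / 2 := by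
  obtain ⟨B, hB, hsum⟩ := exists_sum_exp_le hx one_pos
  obtain ⟨δ, hδ, hsep⟩ := hx
  refine ⟨δ / (4 * (1 + 2 * B / δ)), by positivity, fun s hs hs₀ n i => ?_⟩
  have h1 : 1 + 2 * B / δ ≤ δ / (4 * s) := by
    rw [le_div_iff₀ (by positivity)] at hs₀ ⊢
    linarith
  have key : ∀ j : Fin n, j ≠ i → Real.exp (-(sqNorm (x i - x j) / (4 * s))) ≤
      1 / (2 * B) * Real.exp (-1 * ‖x i - x j‖) := by
    intro j hj
    have h2 : δ ≤ ‖x i - x j‖ := hsep i j fun h => hj (Fin.ext h.symm)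
    have h3 := norm_sq_le_sqNorm (x i - x j)
    set r := ‖x i - x j‖ with hr
    have h4 : r * (1 + 2 * B / δ) ≤ sqNorm (x i - x j) / (4 * s) := by
      calc r * (1 + 2 * B / δ) ≤ r * (δ / (4 * s)) := by gcongr
        _ = r * δ / (4 * s) := by ring
        _ ≤ _ := by
          gcongr
          refine le_trans ?_ h3
          rw [sq]; gcongr
    have h5 : 2 * B ≤ r * (2 * B / δ) := by
      calc 2 * B = δ * (2 * B / δ) := by field_simp
        _ ≤ _ := by gcongr
    have h6 : Real.exp (-(2 * B)) ≤ 1 / (2 * B) := by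
      rw [Real.exp_neg, ← one_div]
      refine one_div_le_one_div_of_le (by positivity) ?_
      have := Real.add_one_le_exp (2 * B)
      linarith
    calc Real.exp (-(sqNorm (x i - x j) / (4 * s))) ≤ Real.exp (-(2 * B) + -1 * r) := by
          rw [Real.exp_le_exp]; linarith
      _ = Real.exp (-(2 * B)) * Real.exp (-1 * r) := Real.exp_add _ _
      _ ≤ _ := by gcongr
  calc _ ≤ ∑ j : Fin n with j ≠ i, 1 / (2 * B) * Real.exp (-1 * ‖x i - x j‖) :=
        Finset.sum_le_sum fun j hj => key j (Finset.mem_filter.1 hj).2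
    _ ≤ ∑ j : Fin n, 1 / (2 * B) * Real.exp (-1 * ‖x i - x j‖) :=
        Finset.sum_le_sum_of_subset_of_nonneg (Finset.filter_subset _ _)
          fun _ _ _ => by positivity
    _ ≤ 1 / (2 * B) * B := by
        rw [← Finset.mul_sum]
        gcongr
        exact hsum n (x i)
    _ = 1 / 2 := by field_simp

end Packing

/-! ### Stationary covariance functions -/

section StationaryCovariance

variable {d : ℕ} {k : Loc d → ℝ}

theorem IsStationaryCovarianceFunction.sum_nonneg (hk : IsStationaryCovarianceFunction k)
    {ι : Type*} [Fintype ι] (y : ι → Loc d) (w : ι → ℝ) :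
    0 ≤ ∑ i, ∑ j, w i * w j * k (y i - y j) := by
  let e := Fintype.equivFin ι
  have h := (hk (Fintype.card ι) (y ∘ e.symm)).dotProduct_mulVec_nonneg (w ∘ e.symm)
  have e1 : star (w ∘ e.symm) ⬝ᵥ ((Matrix.of fun i j =>
      k ((y ∘ e.symm) i - (y ∘ e.symm) j)) *ᵥ (w ∘ e.symm)) =
      ∑ i, ∑ j, w i * w j * k (y i - y j) := by
    simp only [dotProduct, mulVec, star_trivial, Finset.mul_sum, Matrix.of_apply]
    rw [← e.symm.sum_comp]
    refine Finset.sum_congr rfl fun i _ => ?_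
    rw [← e.symm.sum_comp]
    refine Finset.sum_congr rfl fun j _ => ?_
    simp only [Function.comp_apply]
    ring
  rwa [e1] at h

theorem IsStationaryCovarianceFunction.neg_eq (hk : IsStationaryCovarianceFunction k)
    (t : Loc d) : k (-t) = k t := by
  have h := (hk 2 ![0, t]).1.apply 0 1
  simpa using h.symm

/-- The quadratic form of a stationary covariance function, as a function of a common lag `u`, is
largest at `u = 0`. -/
theorem IsStationaryCovarianceFunction.sum_shift_le (hk : IsStationaryCovarianceFunction k)
    {n : ℕ} (y : Fin n → Loc d) (v : Fin n → ℝ) (u : Loc d) :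
    ∑ i, ∑ j, v i * v j * k (y i - y j + u) ≤ ∑ i, ∑ j, v i * v j * k (y i - y j) := by
  have h := hk.sum_nonneg (ι := Fin n ⊕ Fin n) (Sum.elim (fun i => y i + u) y)
    (Sum.elim v fun i => -v i)
  simp only [Fintype.sum_sum_type, Sum.elim_inl, Sum.elim_inr, Finset.sum_add_distrib,
    add_sub_add_right_eq_sub] at h
  have e1 : ∑ i, ∑ j, v i * -v j * k (y i + u - y j)
      = -∑ i, ∑ j, v i * v j * k (y i - y j + u) := by
    simp only [← Finset.sum_neg_distrib]
    refine Finset.sum_congr rfl fun i _ => Finset.sum_congr rfl fun j _ => ?_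
    rw [add_sub_right_comm]; ring
  have e2 : ∑ i, ∑ j, -v i * v j * k (y i - (y j + u))
      = -∑ i, ∑ j, v i * v j * k (y i - y j + u) := by
    rw [Finset.sum_comm]
    simp only [← Finset.sum_neg_distrib]
    refine Finset.sum_congr rfl fun i _ => Finset.sum_congr rfl fun j _ => ?_
    rw [← hk.neg_eq]
    have : -(y j - (y i + u)) = y i - y j + u := by abel
    rw [this]; ring
  have e3 : ∑ i, ∑ j, -v i * -v j * k (y i - y j) = ∑ i, ∑ j, v i * v j * k (y i - y j) := by
    simp
  rw [e1, e2, e3] at h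
  linarith

/-- A correlation function satisfies `|c s - c t|² ≤ 2 (1 - c (s - t))`. -/
theorem IsStationaryCorrelationFunction.sq_sub_le (hk : IsStationaryCorrelationFunction k)
    (s t : Loc d) : (k s - k t) ^ 2 ≤ 2 * (1 - k (s - t)) := by
  have hq : ∀ a : ℝ, 0 ≤ a ^ 2 * 1 + 2 * a * (k s - k t) + 2 * (1 - k (s - t)) := by
    intro a
    have h := hk.1.sum_nonneg ![0, s, t] ![a, 1, -1]
    simp only [Fin.sum_univ_three, Matrix.cons_val, sub_self, zero_sub, sub_zero, hk.2,
      hk.1.neg_eq] at h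
    have : k (t - s) = k (s - t) := by rw [← hk.1.neg_eq, neg_sub]
    rw [this] at h
    nlinarith
  have := hq (-(k s - k t))
  nlinarith

theorem covMatrix_isSymm (hk : IsStationaryCovarianceFunction k) (x : ℕ → Loc d) (n : ℕ) :
    (covMatrix k x n).IsSymm := by
  ext i j
  simp only [covMatrix, transpose_apply, of_apply]
  rw [← hk.neg_eq, neg_sub]

theorem dotProduct_covMatrix_mulVec (k : Loc d → ℝ) (x : ℕ → Loc d) {n : ℕ} (v : Fin n → ℝ) :
    v ⬝ᵥ (covMatrix k x n *ᵥ v) = ∑ i, ∑ j, v i * v j * k (x i - x j) := by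
  simp only [dotProduct, mulVec, Finset.mul_sum, covMatrix, of_apply]
  exact Finset.sum_congr rfl fun i _ => Finset.sum_congr rfl fun j _ => by ring

end StationaryCovariance

/-! ### Gaussian kernels -/

section GaussianKernels

open scoped Matrix.Norms.L2Operator

variable {d : ℕ}

theorem integrable_gaussian {s : ℝ} (hs : 0 < s) :
    Integrable fun f : Loc d => Real.exp (-(s * sqNorm f)) := by
  have h := (GaussianFourier.integrable_cexp_neg_mul_sum_add (b := (s : ℂ)) (ι := Fin d)
    (by simpa using hs) 0).re
  refine h.congr (Eventually.of_forall fun f => ?_)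
  simp only [Pi.zero_apply, zero_mul, Finset.sum_const_zero, add_zero]
  rw [show (-(s : ℂ) * ∑ i, (f i : ℂ) ^ 2) = ((-(s * sqNorm f) : ℝ) : ℂ) by
    simp [sqNorm]]
  exact Complex.exp_ofReal_re _

/-- The cosine transform of a Gaussian. -/
theorem integral_gaussian_mul_cos {s : ℝ} (hs : 0 < s) (u : Loc d) :
    ∫ f : Loc d, Real.exp (-(s * sqNorm f)) * Real.cos (f ⬝ᵥ u) =
      (Real.pi / s) ^ ((d : ℝ) / 2) * Real.exp (-(sqNorm u / (4 * s))) := by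
  have hs' : 0 < (s : ℂ).re := by simpa using hs
  have h1 := GaussianFourier.integrable_cexp_neg_mul_sum_add hs'
    (fun i : Fin d => Complex.I * u i)
  have h2 := GaussianFourier.integral_cexp_neg_mul_sum_add hs'
    (fun i : Fin d => Complex.I * u i)
  have e : ∀ f : Loc d, Real.exp (-(s * sqNorm f)) * Real.cos (f ⬝ᵥ u) =
      RCLike.re (Complex.exp (-(s : ℂ) * ∑ i, (f i : ℂ) ^ 2 + ∑ i, Complex.I * u i * f i)) := by
    intro f
    have : (-(s : ℂ) * ∑ i, (f i : ℂ) ^ 2 + ∑ i, Complex.I * u i * f i)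
        = ((-(s * sqNorm f) : ℝ) : ℂ) + ((f ⬝ᵥ u : ℝ) : ℂ) * Complex.I := by
      simp only [sqNorm, dotProduct]
      push_cast
      rw [Finset.sum_mul]
      congr 1
      · ring
      · exact Finset.sum_congr rfl fun i _ => by ring
    rw [this, Complex.exp_add, ← Complex.ofReal_exp]
    change _ = Complex.re _
    rw [Complex.re_ofReal_mul, Complex.exp_ofReal_mul_I_re]
  simp_rw [e]
  rw [integral_re h1, h2]
  have e2 : (Real.pi / (s : ℂ)) ^ ((Fintype.card (Fin d) : ℂ) / 2) *
      Complex.exp ((∑ i, (Complex.I * (u i : ℂ)) ^ 2) / (4 * s)) =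
      (((Real.pi / s) ^ ((d : ℝ) / 2) * Real.exp (-(sqNorm u / (4 * s))) : ℝ) : ℂ) := by
    rw [Complex.ofReal_mul, Complex.ofReal_cpow (by positivity), Complex.ofReal_exp]
    congr 2
    · push_cast; rfl
    · simp
    · simp only [sqNorm, mul_pow, Complex.I_sq]
      push_cast
      rw [← Finset.mul_sum]; ring
  rw [e2]
  exact Complex.ofReal_re _

/-- The quadratic form of a narrow Gaussian kernel on well separated locations is comparable to the
squared norm. -/
theorem abs_sum_gaussian_sub_le {x : ℕ → Loc d} {s : ℝ} {n : ℕ}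
    (h : ∀ i : Fin n,
      ∑ j : Fin n with j ≠ i, Real.exp (-(sqNorm (x i - x j) / (4 * s))) ≤ 1 / 2)
    (v : Fin n → ℝ) :
    |∑ i, ∑ j, v i * v j * Real.exp (-(sqNorm (x i - x j) / (4 * s))) - v ⬝ᵥ v|
      ≤ 1 / 2 * (v ⬝ᵥ v) := by
  set k : Loc d → ℝ := fun u => Real.exp (-(sqNorm u / (4 * s))) with hk
  have hk0 : k 0 = 1 := by simp [hk, sqNorm]
  have hneg : ∀ u, k (-u) = k u := by intro u; simp [hk, sqNorm]
  have hsymm : (covMatrix k x n - 1).IsSymm := by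
    refine IsSymm.sub ?_ isSymm_one
    ext i j
    simp only [covMatrix, transpose_apply, of_apply]
    rw [← hneg, neg_sub]
  have hnorm : ‖covMatrix k x n - 1‖ ≤ 1 / 2 := by
    refine norm_le_of_sum_abs_le hsymm (by norm_num) fun i => ?_
    refine le_trans (le_of_eq ?_) (h i)
    rw [Finset.sum_filter]
    refine Finset.sum_congr rfl fun j _ => ?_
    by_cases hij : j = i
    · subst hij; simp [covMatrix, hk0]
    · rw [if_pos hij, Matrix.sub_apply, one_apply_ne (Ne.symm hij), sub_zero]
      exact abs_of_nonneg (Real.exp_nonneg _)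
  have := abs_dotProduct_mulVec_le (covMatrix k x n - 1) v
  rw [sub_mulVec, one_mulVec, dotProduct_sub, dotProduct_covMatrix_mulVec] at this
  exact this.trans (mul_le_mul_of_nonneg_right hnorm (dotProduct_self_nonneg' v))

end GaussianKernels

/-! ### Uniform lower bounds for the eigenvalues of covariance matrices -/

section Eigenvalues

variable {d : ℕ}

/-- The cosine transform `∫ k(t) cos(f·t) dt`. -/
noncomputable def cosTransform (k : Loc d → ℝ) (f : Loc d) : ℝ :=
  ∫ t : Loc d, k t * Real.cos (f ⬝ᵥ t)

/-- A nonzero value of the Fourier transform, not being a default value, forces integrability. -/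
theorem integrable_of_fourierTransform_ne_zero {k : Loc d → ℝ}
    (h : fourierTransform k 0 ≠ 0) : Integrable k := by
  have h1 : Integrable fun t : Loc d =>
      (k t : ℂ) * Complex.exp (-Complex.I * (((0 : Loc d) ⬝ᵥ t : ℝ) : ℂ)) := by
    by_contra hn
    exact h (by rw [fourierTransform, integral_undef hn, mul_zero])
  simpa using h1.re

theorem integrable_mul_cos {k : Loc d → ℝ} (hk : Integrable k) (g : Loc d → ℝ)
    (hg : Continuous g) : Integrable fun t => k t * Real.cos (g t) :=
  hk.mul_bdd (c := 1) (by fun_prop) (Eventually.of_forall fun t => Real.abs_cos_le_one _)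

theorem integrable_mul_sin {k : Loc d → ℝ} (hk : Integrable k) (g : Loc d → ℝ)
    (hg : Continuous g) : Integrable fun t => k t * Real.sin (g t) :=
  hk.mul_bdd (c := 1) (by fun_prop) (Eventually.of_forall fun t => Real.abs_sin_le_one _)

theorem continuous_dotProduct_right (f : Loc d) : Continuous fun t : Loc d => f ⬝ᵥ t := by
  unfold dotProduct; fun_prop

theorem continuous_dotProduct_left (u : Loc d) : Continuous fun f : Loc d => f ⬝ᵥ u := by
  unfold dotProduct; fun_prop

theorem cosTransform_eq {k : Loc d → ℝ} (hk : Integrable k) (f : Loc d) :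
    cosTransform k f = (2 * Real.pi) ^ d * (fourierTransform k f).re := by
  have hexp : ∀ t : Loc d, (k t : ℂ) * Complex.exp (-Complex.I * ((f ⬝ᵥ t : ℝ) : ℂ))
      = ((k t * Real.cos (f ⬝ᵥ t) : ℝ) : ℂ) - ((k t * Real.sin (f ⬝ᵥ t) : ℝ) : ℂ) * Complex.I := by
    intro t
    rw [show -Complex.I * ((f ⬝ᵥ t : ℝ) : ℂ) = ((-(f ⬝ᵥ t) : ℝ) : ℂ) * Complex.I by
      push_cast; ring, Complex.exp_mul_I, ← Complex.ofReal_cos, ← Complex.ofReal_sin,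
      Real.cos_neg, Real.sin_neg]
    push_cast; ring
  have hc := integrable_mul_cos hk _ (continuous_dotProduct_right f)
  have hs := integrable_mul_sin hk _ (continuous_dotProduct_right f)
  rw [fourierTransform, Complex.re_ofReal_mul]
  simp_rw [hexp]
  rw [integral_sub hc.ofReal (hs.ofReal.mul_const _), integral_mul_const]
  rw [integral_complex_ofReal, integral_complex_ofReal]
  simp only [Complex.sub_re, Complex.ofReal_re, Complex.re_ofReal_mul, Complex.I_re, mul_zero,
    sub_zero]
  rw [← mul_assoc, mul_inv_cancel₀ (by positivity), one_mul, cosTransform]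

/-- The trigonometric form `∑ vᵢ vⱼ cos(f·(xᵢ - xⱼ)) = |∑ vᵢ exp(i f·xᵢ)|²`. -/
noncomputable def trigForm {n : ℕ} (y : Fin n → Loc d) (v : Fin n → ℝ) (f : Loc d) : ℝ :=
  ∑ i, ∑ j, v i * v j * Real.cos (f ⬝ᵥ (y i - y j))

theorem trigForm_nonneg {n : ℕ} (y : Fin n → Loc d) (v : Fin n → ℝ) (f : Loc d) :
    0 ≤ trigForm y v f := by
  have : trigForm y v f =
      (∑ i, v i * Real.cos (f ⬝ᵥ y i)) ^ 2 + (∑ i, v i * Real.sin (f ⬝ᵥ y i)) ^ 2 := by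
    simp only [trigForm, sq, Finset.sum_mul_sum, ← Finset.sum_add_distrib]
    refine Finset.sum_congr rfl fun i _ => Finset.sum_congr rfl fun j _ => ?_
    rw [dotProduct_sub, Real.cos_sub]; ring
  rw [this]; positivity

@[fun_prop]
theorem continuous_trigForm {n : ℕ} (y : Fin n → Loc d) (v : Fin n → ℝ) :
    Continuous (trigForm y v) := by
  have := fun u : Loc d => continuous_dotProduct_left u
  unfold trigForm
  fun_prop

theorem trigForm_le {n : ℕ} (y : Fin n → Loc d) (v : Fin n → ℝ) (f : Loc d) :
    trigForm y v f ≤ ∑ i, ∑ j, |v i * v j| := by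
  refine Finset.sum_le_sum fun i _ => Finset.sum_le_sum fun j _ => ?_
  calc _ ≤ |v i * v j * Real.cos (f ⬝ᵥ (y i - y j))| := le_abs_self _
    _ = |v i * v j| * |Real.cos (f ⬝ᵥ (y i - y j))| := abs_mul _ _
    _ ≤ |v i * v j| * 1 := by gcongr; exact Real.abs_cos_le_one _
    _ = _ := mul_one _

/-- The cosine transform of the shifted quadratic form of `k` factorizes. -/
theorem integral_sum_shift_mul_cos {k : Loc d → ℝ} (hk : IsStationaryCovarianceFunction k)
    (hint : Integrable k) {n : ℕ} (y : Fin n → Loc d) (v : Fin n → ℝ) (f : Loc d) :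
    ∫ u, (∑ i, ∑ j, v i * v j * k (y i - y j + u)) * Real.cos (f ⬝ᵥ u) =
      cosTransform k f * trigForm y v f := by
  have hsin : ∫ t, k t * Real.sin (f ⬝ᵥ t) = 0 := by
    have h := integral_neg_eq_self (fun t : Loc d => k t * Real.sin (f ⬝ᵥ t)) volume
    simp only [hk.neg_eq, dotProduct_neg, Real.sin_neg, mul_neg, integral_neg] at h
    linarith
  have h1 : ∀ i j, ∫ u, v i * v j * k (y i - y j + u) * Real.cos (f ⬝ᵥ u) =
      v i * v j * (Real.cos (f ⬝ᵥ (y i - y j)) * cosTransform k f) := by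
    intro i j
    set z := y i - y j
    have h2 := integral_add_left_eq_self (μ := volume)
      (fun t : Loc d => k t * Real.cos (f ⬝ᵥ (t - z))) z
    simp only [add_sub_cancel_left] at h2
    simp_rw [mul_assoc]
    rw [integral_const_mul, integral_const_mul, h2]
    congr 2
    have h3 : ∀ t, k t * Real.cos (f ⬝ᵥ (t - z)) =
        Real.cos (f ⬝ᵥ z) * (k t * Real.cos (f ⬝ᵥ t))
          + Real.sin (f ⬝ᵥ z) * (k t * Real.sin (f ⬝ᵥ t)) := by
      intro t; rw [dotProduct_sub, Real.cos_sub]; ring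
    simp_rw [h3]
    rw [integral_add ((integrable_mul_cos hint _ (continuous_dotProduct_right f)).const_mul _)
      ((integrable_mul_sin hint _ (continuous_dotProduct_right f)).const_mul _),
      integral_const_mul, integral_const_mul, hsin, mul_zero, add_zero, cosTransform]
  have h4 : ∀ i j, Integrable fun u => v i * v j * k (y i - y j + u) * Real.cos (f ⬝ᵥ u) :=
    fun i j => integrable_mul_cos ((hint.comp_add_left _).const_mul _) _
      (continuous_dotProduct_right f)
  simp_rw [Finset.sum_mul]
  rw [integral_finsetSum _ fun i _ => integrable_finsetSum _ fun j _ => h4 i j]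
  simp_rw [integral_finsetSum _ fun j _ => h4 _ j, h1, trigForm, Finset.mul_sum]
  refine Finset.sum_congr rfl fun i _ => Finset.sum_congr rfl fun j _ => by ring

theorem integrable_gaussian_mul_trigForm {s : ℝ} (hs : 0 < s) {n : ℕ} (y : Fin n → Loc d)
    (v : Fin n → ℝ) : Integrable fun f => Real.exp (-(s * sqNorm f)) * trigForm y v f :=
  (integrable_gaussian hs).mul_bdd (c := ∑ i, ∑ j, |v i * v j|) (by fun_prop)
    (Eventually.of_forall fun f => by
      rw [Real.norm_of_nonneg (trigForm_nonneg _ _ _)]; exact trigForm_le _ _ _)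

theorem integral_gaussian_mul_trigForm {s : ℝ} (hs : 0 < s) {n : ℕ} (y : Fin n → Loc d)
    (v : Fin n → ℝ) :
    ∫ f, Real.exp (-(s * sqNorm f)) * trigForm y v f =
      (Real.pi / s) ^ ((d : ℝ) / 2) *
        ∑ i, ∑ j, v i * v j * Real.exp (-(sqNorm (y i - y j) / (4 * s))) := by
  have h4 : ∀ i j, Integrable fun f : Loc d =>
      v i * v j * (Real.exp (-(s * sqNorm f)) * Real.cos (f ⬝ᵥ (y i - y j))) :=
    fun i j => (integrable_mul_cos (integrable_gaussian hs) _
      (continuous_dotProduct_left _)).const_mul _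
  have e : ∀ f, Real.exp (-(s * sqNorm f)) * trigForm y v f = ∑ i, ∑ j,
      v i * v j * (Real.exp (-(s * sqNorm f)) * Real.cos (f ⬝ᵥ (y i - y j))) := by
    intro f
    simp only [trigForm, Finset.mul_sum]
    exact Finset.sum_congr rfl fun i _ => Finset.sum_congr rfl fun j _ => by ring
  simp_rw [e]
  rw [integral_finsetSum _ fun i _ => integrable_finsetSum _ fun j _ => h4 i j]
  simp_rw [integral_finsetSum _ fun j _ => h4 _ j, integral_const_mul,
    integral_gaussian_mul_cos hs, Finset.mul_sum]
  exact Finset.sum_congr rfl fun i _ => Finset.sum_congr rfl fun j _ => by ring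

/-- Averaging the shifted quadratic form of `k`, which is largest at zero, against a Gaussian density
bounds the quadratic form from below by an absolutely convergent integral of the cosine
transform. Fourier inversion is not needed, so that `k` may be discontinuous. -/
theorem integral_gaussian_mul_cosTransform_le {k : Loc d → ℝ}
    (hk : IsStationaryCovarianceFunction k) (hint : Integrable k) {s : ℝ} (hs : 0 < s) {n : ℕ}
    (y : Fin n → Loc d) (v : Fin n → ℝ) :
    Integrable (fun f => Real.exp (-(s * sqNorm f)) * (cosTransform k f * trigForm y v f)) ∧
    ∫ f, Real.exp (-(s * sqNorm f)) * (cosTransform k f * trigForm y v f) ≤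
      ((Real.pi / s) ^ ((d : ℝ) / 2) * ∫ u : Loc d, Real.exp (-(sqNorm u / (4 * s)))) *
        ∑ i, ∑ j, v i * v j * k (y i - y j) := by
  set K : Loc d → ℝ := fun u => ∑ i, ∑ j, v i * v j * k (y i - y j + u) with hK
  set K₀ := ∑ i, ∑ j, v i * v j * k (y i - y j) with hK₀
  have hKint : Integrable K := integrable_finsetSum _ fun i _ => integrable_finsetSum _ fun j _ =>
    (hint.comp_add_left _).const_mul _
  have hprod : Integrable (fun p : Loc d × Loc d =>
      (Real.exp (-(s * sqNorm p.1)) * K p.2) * Real.cos (p.1 ⬝ᵥ p.2)) (volume.prod volume) := by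
    refine ((integrable_gaussian hs).mul_prod hKint).mul_bdd (c := 1) ?_
      (Eventually.of_forall fun t => Real.abs_cos_le_one _)
    have : Continuous fun p : Loc d × Loc d => p.1 ⬝ᵥ p.2 := by unfold dotProduct; fun_prop
    fun_prop
  have e : ∀ f, Real.exp (-(s * sqNorm f)) * (cosTransform k f * trigForm y v f) =
      ∫ u, (Real.exp (-(s * sqNorm f)) * K u) * Real.cos (f ⬝ᵥ u) := by
    intro f
    rw [← integral_sum_shift_mul_cos hk hint y v f, ← integral_const_mul]
    exact integral_congr_ae (Eventually.of_forall fun u => by simp only [hK]; ring)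
  simp_rw [e]
  refine ⟨hprod.integral_prod_left, ?_⟩
  rw [integral_integral_swap hprod]
  have e2 : ∀ u, ∫ f, (Real.exp (-(s * sqNorm f)) * K u) * Real.cos (f ⬝ᵥ u) =
      K u * ((Real.pi / s) ^ ((d : ℝ) / 2) * Real.exp (-(sqNorm u / (4 * s)))) := by
    intro u
    rw [← integral_gaussian_mul_cos hs, ← integral_const_mul]
    exact integral_congr_ae (Eventually.of_forall fun f => by ring_nf)
  simp_rw [e2]
  have hs4 : 0 < 1 / (4 * s) := by positivity
  have hg : Integrable fun u : Loc d => Real.exp (-(sqNorm u / (4 * s))) := by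
    refine (integrable_gaussian hs4).congr (Eventually.of_forall fun u => ?_)
    simp only; congr 2; ring
  have hKg : Integrable fun u =>
      K u * ((Real.pi / s) ^ ((d : ℝ) / 2) * Real.exp (-(sqNorm u / (4 * s)))) := by
    refine hKint.mul_bdd (c := (Real.pi / s) ^ ((d : ℝ) / 2)) (by fun_prop)
      (Eventually.of_forall fun u => ?_)
    rw [Real.norm_of_nonneg (by positivity)]
    refine mul_le_of_le_one_right (by positivity) (Real.exp_le_one_iff.2 ?_)
    have := sqNorm_nonneg u
    rw [neg_nonpos]; positivity
  rw [← integral_const_mul, ← integral_mul_const]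
  refine integral_mono hKg ((hg.const_mul _).mul_const _) fun u => ?_
  simp only
  rw [mul_comm (K u)]
  gcongr
  exact hk.sum_shift_le y v u

/-- For a family of stationary covariance functions with jointly continuous positive Fourier
transforms over a compact parameter set, the eigenvalues of the covariance matrices on well
separated locations are bounded below uniformly in the parameter and the number of locations. -/
theorem exists_lower_bound {p : ℕ} {Θ : Set (EuclideanSpace ℝ (Fin p))} (hΘ : IsCompact Θ)
    {k : EuclideanSpace ℝ (Fin p) → Loc d → ℝ}
    (hk : ∀ θ ∈ Θ, IsStationaryCovarianceFunction (k θ)) (hf : PositiveFourierFamily Θ k)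
    {x : ℕ → Loc d} (hx : WellSeparated x) :
    ∃ l : ℝ, 0 < l ∧ ∀ θ ∈ Θ, ∀ (n : ℕ) (v : Fin n → ℝ),
      l * (v ⬝ᵥ v) ≤ v ⬝ᵥ (covMatrix (k θ) x n *ᵥ v) := by
  have hint : ∀ θ ∈ Θ, Integrable (k θ) := fun θ hθ =>
    integrable_of_fourierTransform_ne_zero fun h => by
      have := (hf.2 θ hθ 0).2
      simp [h] at this
  obtain ⟨s, hs, hgauss⟩ := exists_sum_gaussian_le hx
  have hs2 : 0 < s / 2 := by positivity
  set a : ℝ := (Real.pi / s) ^ ((d : ℝ) / 2) with ha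
  set a' : ℝ := (Real.pi / (s / 2)) ^ ((d : ℝ) / 2) with ha'
  have hapos : 0 < a := by positivity
  have ha'pos : 0 < a' := by positivity
  -- the radius outside which the Gaussian weight contributes at most half of the lower bound
  obtain ⟨R, hR, hR0⟩ : ∃ R : ℝ, Real.exp (-(s / 2 * R ^ 2)) * (a' * (3 / 2)) ≤ a / 4 ∧ 0 ≤ R := by
    have h1 : Tendsto (fun R : ℝ => Real.exp (-(s / 2 * R ^ 2)) * (a' * (3 / 2))) atTop
        (𝓝 (0 * (a' * (3 / 2)))) := by
      refine (Real.tendsto_exp_neg_atTop_nhds_zero.comp ?_).mul_const _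
      exact (tendsto_pow_atTop (by norm_num)).const_mul_atTop hs2
    rw [zero_mul] at h1
    exact ((h1.eventually_le_const (by positivity)).and (eventually_ge_atTop 0)).exists
  obtain ⟨ε, hε, hεle⟩ : ∃ ε : ℝ, 0 < ε ∧ ∀ θ ∈ Θ, ∀ f ∈ Metric.closedBall (0 : Loc d) R,
      ε ≤ cosTransform (k θ) f := by
    have hcomp : IsCompact (Θ ×ˢ Metric.closedBall (0 : Loc d) R) :=
      hΘ.prod (isCompact_closedBall _ _)
    have hcont : ContinuousOn (fun q : EuclideanSpace ℝ (Fin p) × Loc d =>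
        (2 * Real.pi) ^ d * (fourierTransform (k q.1) q.2).re)
        (Θ ×ˢ Metric.closedBall (0 : Loc d) R) :=
      continuousOn_const.mul (Complex.continuous_re.comp_continuousOn
        (hf.1.mono (Set.prod_mono le_rfl (Set.subset_univ _))))
    rcases (Θ ×ˢ Metric.closedBall (0 : Loc d) R).eq_empty_or_nonempty with he | hne
    · exact ⟨1, one_pos, fun θ hθ f hf' => absurd (Set.mk_mem_prod hθ hf') (by simp [he])⟩
    · obtain ⟨q, hq, hmin⟩ := hcomp.exists_isMinOn hne hcont
      refine ⟨(2 * Real.pi) ^ d * (fourierTransform (k q.1) q.2).re,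
        mul_pos (by positivity) (hf.2 q.1 hq.1 q.2).2, fun θ hθ f hf' => ?_⟩
      rw [cosTransform_eq (hint θ hθ)]
      exact hmin (Set.mk_mem_prod hθ hf')
  -- the total mass of the weight against which the shifted quadratic form is averaged
  set N : ℝ := a * ∫ u : Loc d, Real.exp (-(sqNorm u / (4 * s))) with hN
  have hs4 : 0 < 1 / (4 * s) := by positivity
  have hNpos : 0 < N := by
    have e : ∀ u : Loc d, Real.exp (-(sqNorm u / (4 * s)))
        = Real.exp (-(1 / (4 * s) * sqNorm u)) := fun u => by congr 2; ring
    refine mul_pos hapos ?_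
    simp_rw [e]
    exact integral_exp_pos (integrable_gaussian hs4)
  refine ⟨ε * (a / 4) / N, by positivity, fun θ hθ n v => ?_⟩
  set y : Fin n → Loc d := fun i => x i with hy
  obtain ⟨hI, hle⟩ := integral_gaussian_mul_cosTransform_le (hk θ hθ) (hint θ hθ) hs y v
  rw [dotProduct_covMatrix_mulVec]
  have hm := integrable_gaussian_mul_trigForm hs y v
  have hm2 := integrable_gaussian_mul_trigForm hs2 y v
  have hv := dotProduct_self_nonneg' v
  have b1 := abs_le.1 (abs_sum_gaussian_sub_le (hgauss s hs le_rfl n) v)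
  have b2 := abs_le.1 (abs_sum_gaussian_sub_le (hgauss (s / 2) hs2 (by linarith) n) v)
  have c1 : a * (1 / 2 * (v ⬝ᵥ v)) ≤ ∫ f, Real.exp (-(s * sqNorm f)) * trigForm y v f := by
    rw [integral_gaussian_mul_trigForm hs]
    gcongr
    linarith [b1.1]
  have c2 : ∫ f, Real.exp (-(s / 2 * sqNorm f)) * trigForm y v f ≤ a' * (3 / 2 * (v ⬝ᵥ v)) := by
    rw [integral_gaussian_mul_trigForm hs2]
    gcongr
    linarith [b2.2]
  -- The weight `exp (-s |f|²)` is at most `exp (-s R² / 2) * exp (-s |f|² / 2)` outside of the ball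
  -- of radius `R`; the last factor is again a Gaussian weight to which the upper bound applies.
  have hpt : ∀ f, ε * (Real.exp (-(s * sqNorm f)) * trigForm y v f)
      - ε * (Real.exp (-(s / 2 * R ^ 2)) * (Real.exp (-(s / 2 * sqNorm f)) * trigForm y v f))
      ≤ Real.exp (-(s * sqNorm f)) * (cosTransform (k θ) f * trigForm y v f) := by
    intro f
    have t0 := trigForm_nonneg y v f
    by_cases hfR : f ∈ Metric.closedBall (0 : Loc d) R
    · have := hεle θ hθ f hfR
      have h1 : ε * (Real.exp (-(s * sqNorm f)) * trigForm y v f) ≤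
          Real.exp (-(s * sqNorm f)) * (cosTransform (k θ) f * trigForm y v f) := by
        rw [mul_left_comm]; gcongr
      have h2 : 0 ≤ ε * (Real.exp (-(s / 2 * R ^ 2)) *
        (Real.exp (-(s / 2 * sqNorm f)) * trigForm y v f)) := by positivity
      linarith
    · have hpos : 0 < cosTransform (k θ) f := by
        rw [cosTransform_eq (hint θ hθ)]
        exact mul_pos (by positivity) (hf.2 θ hθ f).2
      have hRf : R ^ 2 ≤ sqNorm f := by
        rw [mem_closedBall_zero_iff, not_le] at hfR
        exact (pow_le_pow_left₀ hR0 hfR.le 2).trans (norm_sq_le_sqNorm f)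
      have h1 : Real.exp (-(s * sqNorm f)) ≤
          Real.exp (-(s / 2 * R ^ 2)) * Real.exp (-(s / 2 * sqNorm f)) := by
        rw [← Real.exp_add, Real.exp_le_exp]
        nlinarith
      have h2 : 0 ≤ Real.exp (-(s * sqNorm f)) * (cosTransform (k θ) f * trigForm y v f) := by
        positivity
      have h3 : ε * (Real.exp (-(s * sqNorm f)) * trigForm y v f) ≤ ε *
          (Real.exp (-(s / 2 * R ^ 2)) * (Real.exp (-(s / 2 * sqNorm f)) * trigForm y v f)) := by
        rw [← mul_assoc (Real.exp (-(s / 2 * R ^ 2)))]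
        gcongr
      linarith
  have hfin := integral_mono ((hm.const_mul ε).sub ((hm2.const_mul _).const_mul ε)) hI hpt
  simp only [Pi.sub_apply] at hfin
  rw [integral_sub (hm.const_mul ε) ((hm2.const_mul _).const_mul ε), integral_const_mul,
    integral_const_mul, integral_const_mul] at hfin
  have d2 : Real.exp (-(s / 2 * R ^ 2)) * ∫ f, Real.exp (-(s / 2 * sqNorm f)) * trigForm y v f
      ≤ a / 4 * (v ⬝ᵥ v) := by
    calc _ ≤ Real.exp (-(s / 2 * R ^ 2)) * (a' * (3 / 2 * (v ⬝ᵥ v))) := by gcongr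
      _ = (Real.exp (-(s / 2 * R ^ 2)) * (a' * (3 / 2))) * (v ⬝ᵥ v) := by ring
      _ ≤ _ := by gcongr
  rw [div_mul_eq_mul_div, div_le_iff₀ hNpos]
  have d1 := mul_le_mul_of_nonneg_left c1 hε.le
  have d3 := mul_le_mul_of_nonneg_left d2 hε.le
  nlinarith

end Eigenvalues

/-! ### Uniform continuity of the correlation model in its parameter -/

section Equicontinuity

variable {d q : ℕ}

/-- The parameter `(a, ψ)`. -/
def consParam (a : ℝ) (ψ : EuclideanSpace ℝ (Fin q)) : EuclideanSpace ℝ (Fin (q + 1)) :=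
  WithLp.toLp 2 (Fin.cons a ψ.ofLp)

@[simp]
theorem covFamily_consParam (c : EuclideanSpace ℝ (Fin q) → Loc d → ℝ) (a : ℝ)
    (ψ : EuclideanSpace ℝ (Fin q)) (s : Loc d) : covFamily c (consParam a ψ) s = a * c ψ s := rfl

theorem norm_consParam_sub (a : ℝ) (ψ ψ' : EuclideanSpace ℝ (Fin q)) :
    ‖consParam a ψ - consParam a ψ'‖ = ‖ψ - ψ'‖ := by
  rw [EuclideanSpace.norm_eq, EuclideanSpace.norm_eq, Fin.sum_univ_succ]
  simp [consParam]

theorem continuous_consParam (a : ℝ) :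
    Continuous (consParam a : EuclideanSpace ℝ (Fin q) → _) :=
  (Isometry.of_dist_eq fun ψ ψ' => by
    rw [dist_eq_norm, dist_eq_norm, norm_consParam_sub]).continuous

theorem consParam_mem {a b t : ℝ} {S : Set (EuclideanSpace ℝ (Fin q))} (ht : t ∈ Set.Icc a b)
    {ψ : EuclideanSpace ℝ (Fin q)} (hψ : ψ ∈ S) : consParam t ψ ∈ paramSet a b S := ⟨ht, hψ⟩

/-- A linear form on Euclidean space is bounded by its values on the coordinate vectors. -/
theorem norm_le_of_forall_single {p : ℕ} {L : EuclideanSpace ℝ (Fin p) →L[ℝ] ℝ} {C : ℝ}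
    (hC : 0 ≤ C) (h : ∀ i, |L (EuclideanSpace.single i 1)| ≤ C) : ‖L‖ ≤ p * C := by
  refine L.opNorm_le_bound (by positivity) fun v => ?_
  have e : v = ∑ i, v i • EuclideanSpace.single i (1 : ℝ) := by
    ext j
    simp [Finset.sum_apply, Pi.single_apply]
  rw [e, map_sum, ← e]
  calc ‖∑ i, L (v i • EuclideanSpace.single i 1)‖ ≤ ∑ i, ‖L (v i • EuclideanSpace.single i 1)‖ :=
        norm_sum_le _ _
    _ ≤ ∑ _i : Fin p, C * ‖v‖ := by
        refine Finset.sum_le_sum fun i _ => ?_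
        rw [map_smul, norm_smul, mul_comm]
        exact mul_le_mul (h i) (PiLp.norm_apply_le v i) (norm_nonneg _) hC
    _ = _ := by simp; ring

/-- The mean value inequality along a Lipschitz curve that need not be differentiable. The additive
constant `2` leaves room for the error of linearization and for a strict inequality of slopes. -/
theorem abs_sub_le_of_lipschitz_path {E : Type*} [NormedAddCommGroup E] [NormedSpace ℝ E]
    {g : E → ℝ} {γ : ℝ → E} {L ε : ℝ} (hL : 0 ≤ L) (hε : 0 < ε)
    (hγ : ∀ t ∈ Set.Icc (0 : ℝ) 1, ∀ u ∈ Set.Icc (0 : ℝ) 1, ‖γ t - γ u‖ ≤ ε * |t - u|)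
    (hg : ∀ t ∈ Set.Icc (0 : ℝ) 1, DifferentiableAt ℝ g (γ t))
    (hg' : ∀ t ∈ Set.Icc (0 : ℝ) 1, ‖fderiv ℝ g (γ t)‖ ≤ L) :
    |g (γ 1) - g (γ 0)| ≤ (L + 2) * ε := by
  have hγc : ContinuousOn γ (Set.Icc 0 1) := by
    refine LipschitzOnWith.continuousOn (K := ⟨ε, hε.le⟩) ?_
    refine LipschitzOnWith.of_dist_le_mul fun t ht u hu => ?_
    rw [dist_eq_norm, Real.dist_eq]
    exact hγ t ht u hu
  have hcont : ContinuousOn (fun t => g (γ t) - g (γ 0)) (Set.Icc 0 1) :=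
    (ContinuousOn.sub (fun t ht =>
      (hg t ht).continuousAt.comp_continuousWithinAt (hγc t ht)) continuousOn_const)
  have h := image_norm_le_of_liminf_right_slope_norm_lt_deriv_boundary
    (f := fun t => g (γ t) - g (γ 0)) (f' := fun _ => (L + 1) * ε) (a := 0) (b := 1)
    (B := fun t => (L + 2) * ε * t) (B' := fun _ => (L + 2) * ε) hcont ?_ (by simp)
    (by fun_prop)
    (fun t _ => by simpa using ((hasDerivAt_id t).const_mul ((L + 2) * ε)).hasDerivWithinAt)
    (fun t _ _ => by nlinarith) (x := 1) (by simp)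
  · simpa using h
  · intro t ht r hr
    have ht' : t ∈ Set.Icc (0 : ℝ) 1 := Set.Ico_subset_Icc_self ht
    have hdiff := (hg t ht').hasFDerivAt.isLittleO.def one_pos
    have htend : Tendsto γ (𝓝[>] t) (𝓝 (γ t)) := by
      refine (hγc t ht').tendsto.mono_left ?_
      refine le_trans ?_ (nhdsWithin_mono t (s := Set.Ioo t 1)
        fun z hz => ⟨ht.1.trans hz.1.le, hz.2.le⟩)
      rw [nhdsWithin_Ioo_eq_nhdsGT ht.2]
    have hev : ∀ᶠ z in 𝓝[>] t, z ∈ Set.Ioo t 1 := Ioo_mem_nhdsGT ht.2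
    refine Eventually.frequently ?_
    filter_upwards [htend.eventually hdiff, hev] with z hz hzI
    have hz' : z ∈ Set.Icc (0 : ℝ) 1 := ⟨ht.1.trans hzI.1.le, hzI.2.le⟩
    have hpos : 0 < z - t := sub_pos.2 hzI.1
    have h1 : ‖g (γ z) - g (γ t)‖ ≤ (L + 1) * (ε * (z - t)) := by
      have h2 := norm_le_norm_sub_add (g (γ z) - g (γ t)) (fderiv ℝ g (γ t) (γ z - γ t))
      have h3 := (fderiv ℝ g (γ t)).le_of_opNorm_le (hg' t ht') (γ z - γ t)
      have h4 := hγ z hz' t ht'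
      rw [abs_of_pos hpos] at h4
      calc _ ≤ 1 * ‖γ z - γ t‖ + L * ‖γ z - γ t‖ := h2.trans (add_le_add hz h3)
        _ = (L + 1) * ‖γ z - γ t‖ := by ring
        _ ≤ _ := by gcongr
    refine lt_of_le_of_lt ?_ hr
    rw [slope_def_field, div_le_iff₀ hpos]
    have h5 := norm_sub_norm_le (g (γ z) - g (γ 0)) (g (γ t) - g (γ 0))
    rw [sub_sub_sub_cancel_right] at h5
    simp only [Function.comp_apply]
    linarith

/-- Uniform continuity in the parameter when nearby parameters are joined by short curves. -/
theorem exists_abs_sub_le_of_shortPaths {σ₁ σ₂ : ℝ} (h₁ : 0 < σ₁) (h₁₂ : σ₁ ≤ σ₂)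
    {S : Set (EuclideanSpace ℝ (Fin q))} {c : EuclideanSpace ℝ (Fin q) → Loc d → ℝ}
    (hS : HasShortPaths S) (hsmooth : SmoothFamily (paramSet σ₁ σ₂ S) (covFamily c))
    {ψ : EuclideanSpace ℝ (Fin q)} (hψ : ψ ∈ S) {ε : ℝ} (hε : 0 < ε) :
    ∃ δ : ℝ, 0 < δ ∧ ∀ ψ' ∈ S, ‖ψ' - ψ‖ < δ → ∀ s, |c ψ' s - c ψ s| ≤ ε := by
  obtain ⟨hdiff, -, C, e, he, hC⟩ := hsmooth
  have hmem : ∀ {ψ}, ψ ∈ S → consParam σ₁ ψ ∈ paramSet σ₁ σ₂ S := fun h =>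
    consParam_mem ⟨le_rfl, h₁₂⟩ h
  have hC' : ∀ θ ∈ paramSet σ₁ σ₂ S, ∀ s, ∀ i : Fin (q + 1),
      |fderiv ℝ (fun η => covFamily c η s) θ (EuclideanSpace.single i 1)| ≤
        C / (1 + ‖s‖ ^ ((d : ℝ) + e)) := by
    intro θ hθ s i
    have := hC θ hθ s 1 le_rfl (by norm_num) fun _ => i
    rwa [iteratedFDeriv_one_apply] at this
  have hC0 : 0 ≤ C := by
    have := (abs_nonneg _).trans (hC' _ (hmem hψ) 0 0)
    have h2 : 0 < 1 + ‖(0 : Loc d)‖ ^ ((d : ℝ) + e) := by positivity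
    rwa [le_div_iff₀ h2, zero_mul] at this
  set L : ℝ := (q + 1 : ℕ) * C with hL
  have hL0 : 0 ≤ L := by positivity
  obtain ⟨δ, hδ, hpath⟩ := hS (ε * σ₁ / (L + 2)) (by positivity)
  refine ⟨δ, hδ, fun ψ' hψ' hlt s => ?_⟩
  obtain ⟨γ, hγ0, hγ1, hγS, hγL⟩ := hpath ψ hψ ψ' hψ' (by rwa [norm_sub_rev])
  have key := abs_sub_le_of_lipschitz_path (g := fun η => covFamily c η s)
    (γ := fun t => consParam σ₁ (γ t)) (L := L) (ε := ε * σ₁ / (L + 2)) hL0 (by positivity)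
    (fun t ht u hu => by rw [norm_consParam_sub]; exact hγL t ht u hu)
    (fun t ht => (hdiff s _ (hmem (hγS t ht))).differentiableAt (by norm_num))
    (fun t ht => norm_le_of_forall_single hC0 fun i =>
      (hC' _ (hmem (hγS t ht)) s i).trans (div_le_self hC0 (by
        have : 0 ≤ ‖s‖ ^ ((d : ℝ) + e) := by positivity
        linarith)))
  simp only [covFamily_consParam, hγ0, hγ1] at key
  rw [← mul_sub, abs_mul, abs_of_pos h₁, mul_div_cancel₀ _ (by positivity), mul_comm ε] at key
  exact le_of_mul_le_mul_left key h₁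

/-- Uniform continuity in the parameter when the limiting correlation function is continuous at
zero: by positive definiteness the functions are close to their averages over small balls, and the
averages converge uniformly since the functions converge in `L¹`. -/
theorem exists_abs_sub_le_of_continuous {S : Set (EuclideanSpace ℝ (Fin q))}
    {c : EuclideanSpace ℝ (Fin q) → Loc d → ℝ}
    (hc : ∀ ψ ∈ S, IsStationaryCorrelationFunction (c ψ)) (hint : ∀ ψ ∈ S, Integrable (c ψ))
    (hcont : ∀ ψ ∈ S, ∀ s, ContinuousWithinAt (fun η => c η s) S ψ)
    {C e : ℝ} (he : 0 < e) (hC : ∀ ψ ∈ S, ∀ s, |c ψ s| ≤ C * Real.exp (-e * ‖s‖))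
    {ψ : EuclideanSpace ℝ (Fin q)} (hψ : ψ ∈ S) (hψc : Continuous (c ψ)) {ε : ℝ} (hε : 0 < ε) :
    ∃ δ : ℝ, 0 < δ ∧ ∀ ψ' ∈ S, ‖ψ' - ψ‖ < δ → ∀ s, |c ψ' s - c ψ s| ≤ ε := by
  set η : ℝ := ε / 4 with hη
  have hη0 : 0 < η := by positivity
  obtain ⟨r, hr, hr1⟩ : ∃ r : ℝ, 0 < r ∧ ∀ u ∈ Metric.ball (0 : Loc d) r, 1 - c ψ u ≤ η ^ 2 := by
    obtain ⟨r, hr, h⟩ := Metric.continuousAt_iff.1 hψc.continuousAt (η ^ 2) (by positivity)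
    refine ⟨r, hr, fun u hu => ?_⟩
    have h2 := h hu
    rw [(hc ψ hψ).2, Real.dist_eq] at h2
    linarith [(abs_lt.1 h2).1]
  set V : ℝ := volume.real (Metric.ball (0 : Loc d) r) with hV
  have hVpos : 0 < V :=
    ENNReal.toReal_pos (Metric.measure_ball_pos _ _ hr).ne' measure_ball_lt_top.ne
  have hlim : Tendsto (fun ψ' => ∫ u, |c ψ' u - c ψ u|) (𝓝[S] ψ) (𝓝 0) := by
    have h0 : (0 : ℝ) = ∫ _ : Loc d, (0 : ℝ) := by simp
    rw [h0]
    refine tendsto_integral_filter_of_dominated_convergence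
      (fun u => 2 * (C * Real.exp (-e * ‖u‖))) ?_ ?_
      (((integrable_exp_neg_mul_norm he).const_mul C).const_mul 2)
      (Eventually.of_forall fun u => ?_)
    · filter_upwards [self_mem_nhdsWithin] with ψ' hψ'
      exact ((hint ψ' hψ').sub (hint ψ hψ)).abs.aestronglyMeasurable
    · filter_upwards [self_mem_nhdsWithin] with ψ' hψ'
      refine Eventually.of_forall fun u => ?_
      rw [Real.norm_eq_abs, abs_abs]
      have := abs_sub (c ψ' u) (c ψ u)
      linarith [hC ψ' hψ' u, hC ψ hψ u]
    · have h1 := ((hcont ψ hψ u).tendsto.sub_const (c ψ u)).abs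
      simpa using h1
  have hev := hlim.eventually_lt_const (u := η * V / (1 / η + 1)) (by positivity)
  obtain ⟨δ, hδ, hev⟩ := Metric.mem_nhdsWithin_iff.1 hev
  refine ⟨δ, hδ, fun ψ' hψ' hlt s => ?_⟩
  have hD : ∫ u, |c ψ' u - c ψ u| < η * V / (1 / η + 1) :=
    hev ⟨by rwa [Metric.mem_ball, dist_eq_norm], hψ'⟩
  set Δ : Loc d → ℝ := fun u => |c ψ' u - c ψ u| with hΔ
  have hΔint : Integrable Δ := ((hint ψ' hψ').sub (hint ψ hψ)).abs
  have hΔint' : Integrable fun u => Δ (s - u) := hΔint.comp_sub_left s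
  have hΔ0 : ∀ u, 0 ≤ Δ u := fun u => abs_nonneg _
  -- `Δ s` is bounded by quantities at `u` and `s - u`, to be averaged over small lags `u`
  have hpt : ∀ u ∈ Metric.ball (0 : Loc d) r, Δ s ≤ 3 * η + (Δ u * (1 / η) + Δ (s - u)) := by
    intro u hu
    have key : ∀ ψ₁ ∈ S, |c ψ₁ s - c ψ₁ (s - u)| ≤ η / 2 + (1 - c ψ₁ u) * (1 / η) := by
      intro ψ₁ h₁
      have h := (hc ψ₁ h₁).sq_sub_le s (s - u)
      rw [sub_sub_cancel] at h
      set t := c ψ₁ s - c ψ₁ (s - u)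
      have h2 : |t| ≤ η / 2 + t ^ 2 / (2 * η) := by
        have e : η / 2 + t ^ 2 / (2 * η) - |t| = (|t| - η) ^ 2 / (2 * η) := by
          rw [← sq_abs t]; field_simp; ring
        have : 0 ≤ (|t| - η) ^ 2 / (2 * η) := by positivity
        linarith
      have h3 : t ^ 2 / (2 * η) ≤ (1 - c ψ₁ u) * (1 / η) := by
        rw [div_le_iff₀ (by positivity)]
        field_simp
        linarith
      linarith
    have k1 := key ψ' hψ'
    have k2 := key ψ hψ
    have h1 := hr1 u hu
    have h2 : (1 - c ψ u) * (1 / η) ≤ η := by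
      rw [mul_one_div, div_le_iff₀ hη0, ← sq]; exact h1
    have h3 : (1 - c ψ' u) * (1 / η) ≤ η + Δ u * (1 / η) := by
      have : 1 - c ψ' u ≤ (1 - c ψ u) + Δ u := by
        have := neg_abs_le (c ψ' u - c ψ u)
        simp only [hΔ]; linarith
      calc _ ≤ ((1 - c ψ u) + Δ u) * (1 / η) := by gcongr
        _ = (1 - c ψ u) * (1 / η) + Δ u * (1 / η) := by ring
        _ ≤ _ := by gcongr
    have h4 : Δ s ≤ |c ψ' s - c ψ' (s - u)| + Δ (s - u) + |c ψ s - c ψ (s - u)| := by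
      simp only [hΔ]
      rw [abs_sub_comm (c ψ s)]
      have := abs_add_three (c ψ' s - c ψ' (s - u)) (c ψ' (s - u) - c ψ (s - u))
        (c ψ (s - u) - c ψ s)
      refine le_trans (le_of_eq ?_) this
      congr 1; ring
    linarith
  have hI : V * Δ s ≤ V * (3 * η) + (1 / η + 1) * ∫ u, Δ u := by
    have hW : Integrable fun u => Δ u * (1 / η) + Δ (s - u) := (hΔint.mul_const _).add hΔint'
    have hconst : Integrable (fun _ : Loc d => 3 * η)
        (volume.restrict (Metric.ball (0 : Loc d) r)) :=
      integrableOn_const measure_ball_lt_top.ne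
    have hI1 : ∫ u in Metric.ball (0 : Loc d) r, Δ s ≤
        ∫ u in Metric.ball (0 : Loc d) r, (3 * η + (Δ u * (1 / η) + Δ (s - u))) :=
      setIntegral_mono_on (by simp [measure_ball_lt_top])
        (hconst.add hW.integrableOn) measurableSet_ball hpt
    rw [setIntegral_const, integral_add hconst hW.integrableOn,
      setIntegral_const] at hI1
    have hI2 : ∫ u in Metric.ball (0 : Loc d) r, (Δ u * (1 / η) + Δ (s - u)) ≤
        ∫ u, (Δ u * (1 / η) + Δ (s - u)) :=
      setIntegral_le_integral hW (Eventually.of_forall fun u =>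
        add_nonneg (mul_nonneg (hΔ0 u) (by positivity)) (hΔ0 _))
    rw [integral_add (hΔint.mul_const _) hΔint', integral_mul_const,
      integral_sub_left_eq_self Δ volume s] at hI2
    simp only [smul_eq_mul] at hI1
    linarith
  have hD' : (1 / η + 1) * ∫ u, Δ u ≤ η * V := by
    rw [lt_div_iff₀ (by positivity)] at hD
    linarith
  have : V * Δ s ≤ V * ε := by
    have h4 : ε = 4 * η := by rw [hη]; ring
    rw [h4]
    linarith
  exact le_of_mul_le_mul_left this hVpos

end Equicontinuity

/-! ### A Poincaré inequality for centered Gaussian measures -/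

section Poincare

theorem sq_intervalIntegral_le {a b : ℝ} (hab : a < b) {g : ℝ → ℝ} (hg : Continuous g) :
    (∫ t in a..b, g t) ^ 2 ≤ (b - a) * ∫ t in a..b, g t ^ 2 := by
  set m := (∫ t in a..b, g t) / (b - a) with hm
  have hL : 0 < b - a := sub_pos.2 hab
  have hI : ∀ {f : ℝ → ℝ}, Continuous f → IntervalIntegrable f volume a b :=
    fun hf => hf.intervalIntegrable _ _
  have h0 : 0 ≤ ∫ t in a..b, (g t - m) ^ 2 :=
    intervalIntegral.integral_nonneg hab.le fun t _ => sq_nonneg _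
  have e : ∫ t in a..b, (g t - m) ^ 2
      = (∫ t in a..b, g t ^ 2) - (2 * m) * (∫ t in a..b, g t) + (b - a) * m ^ 2 := by
    have : ∀ t, (g t - m) ^ 2 = g t ^ 2 - (2 * m) * g t + m ^ 2 := fun t => by ring
    simp_rw [this]
    rw [intervalIntegral.integral_add (hI (by fun_prop)) (hI (by fun_prop)),
      intervalIntegral.integral_sub (hI (by fun_prop)) (hI (by fun_prop)),
      intervalIntegral.integral_const_mul, intervalIntegral.integral_const, smul_eq_mul]
  rw [e] at h0
  have hmul : (∫ t in a..b, g t) = m * (b - a) := by rw [hm]; field_simp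
  rw [hmul] at h0 ⊢
  nlinarith

variable {E : Type*} [NormedAddCommGroup E] [NormedSpace ℝ E] [MeasurableSpace E] [BorelSpace E]
  [SecondCountableTopology E] [CompleteSpace E]

/-- A Poincaré inequality, by the argument of Maurey and Pisier: for independent `X`, `Y` with
centered Gaussian law `μ`, the path `cos t • X + sin t • Y` and its velocity have the joint law of
`X` and `Y` at each time. -/
theorem integral_prod_sub_sq_le (μ : Measure E) [IsGaussian μ]
    (hμ : ∀ L : StrongDual ℝ E, μ[L] = 0) {F : E → ℝ} {F' : E → E →L[ℝ] ℝ}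
    (hF : ∀ x, HasFDerivAt F (F' x) x) (hF'c : Continuous F') {K : ℝ} (hK : ∀ x, ‖F' x‖ ≤ K)
    {V : ℝ} (hV : ∀ x, ∫ z, (F' x z) ^ 2 ∂μ ≤ V) :
    ∫ p : E × E, (F p.2 - F p.1) ^ 2 ∂(μ.prod μ) ≤ (Real.pi / 2) ^ 2 * V := by
  have hpi : (0 : ℝ) < Real.pi / 2 := by positivity
  set G : E × E → ℝ := fun p => (F' p.1 p.2) ^ 2 with hG
  have hGc : Continuous G := by
    have : Continuous fun p : E × E => F' p.1 p.2 :=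
      (hF'c.comp continuous_fst).clm_apply continuous_snd
    fun_prop
  have hFc : Continuous F := continuous_iff_continuousAt.2 fun x => (hF x).continuousAt
  have hK0 : 0 ≤ K := (norm_nonneg _).trans (hK 0)
  have hnorm2 : Integrable (fun x : E => ‖x‖ ^ 2) μ :=
    (IsGaussian.memLp_two_id (μ := μ)).integrable_norm_pow (by norm_num)
  have hdom : Integrable (fun p : E × E => 2 * K ^ 2 * (‖p.1‖ ^ 2 + ‖p.2‖ ^ 2)) (μ.prod μ) := by
    refine Integrable.const_mul ?_ _
    exact (hnorm2.comp_fst μ).add (hnorm2.comp_snd μ)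
  have hGle : ∀ (p : E × E), ‖G p‖ ≤ K ^ 2 * ‖p.2‖ ^ 2 := by
    intro p
    rw [hG, Real.norm_of_nonneg (sq_nonneg _), ← mul_pow, ← sq_abs]
    exact pow_le_pow_left₀ (abs_nonneg _) ((F' p.1).le_of_opNorm_le (hK _) _) 2
  have hrot : ∀ t, (μ.prod μ).map (ContinuousLinearMap.rotation t) = μ.prod μ :=
    IsGaussian.map_rotation_eq_self_of_forall_strongDual_eq_zero hμ
  have hsc : ∀ t : ℝ, ∀ p : E × E, ‖-Real.sin t • p.1 + Real.cos t • p.2‖ ^ 2 ≤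
      2 * (‖p.1‖ ^ 2 + ‖p.2‖ ^ 2) := by
    intro t p
    have h1 : ‖-Real.sin t • p.1 + Real.cos t • p.2‖ ≤ ‖p.1‖ + ‖p.2‖ := by
      refine (norm_add_le _ _).trans (add_le_add ?_ ?_) <;> rw [norm_smul]
      · refine mul_le_of_le_one_left (norm_nonneg _) ?_
        rw [norm_neg]; exact Real.abs_sin_le_one t
      · exact mul_le_of_le_one_left (norm_nonneg _) (Real.abs_cos_le_one t)
    calc _ ≤ (‖p.1‖ + ‖p.2‖) ^ 2 := by gcongr
      _ ≤ _ := by nlinarith [sq_nonneg (‖p.1‖ - ‖p.2‖)]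
  have hRc : Continuous fun q : (E × E) × ℝ => ContinuousLinearMap.rotation q.2 q.1 := by
    simp only [ContinuousLinearMap.rotation_apply]; fun_prop
  have hGR : ∀ (p : E × E) t, ‖G (ContinuousLinearMap.rotation t p)‖ ≤
      2 * K ^ 2 * (‖p.1‖ ^ 2 + ‖p.2‖ ^ 2) := by
    intro p t
    refine (hGle _).trans ?_
    rw [ContinuousLinearMap.rotation_apply]
    have := hsc t p
    calc _ ≤ K ^ 2 * (2 * (‖p.1‖ ^ 2 + ‖p.2‖ ^ 2)) := by gcongr
      _ = _ := by ring
  have hpt : ∀ p : E × E, (F p.2 - F p.1) ^ 2 ≤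
      (Real.pi / 2) * ∫ t in (0 : ℝ)..(Real.pi / 2), G (ContinuousLinearMap.rotation t p) := by
    intro p
    set γ : ℝ → E := fun t => Real.cos t • p.1 + Real.sin t • p.2 with hγ
    set γ' : ℝ → E := fun t => -Real.sin t • p.1 + Real.cos t • p.2 with hγ'
    have hder : ∀ t, HasDerivAt γ (γ' t) t := fun t =>
      ((Real.hasDerivAt_cos t).smul_const _).add ((Real.hasDerivAt_sin t).smul_const _)
    have hder2 : ∀ t, HasDerivAt (fun t => F (γ t)) (F' (γ t) (γ' t)) t := fun t =>
      (hF (γ t)).comp_hasDerivAt t (hder t)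
    have hcont : Continuous fun t => F' (γ t) (γ' t) :=
      (hF'c.comp (by fun_prop)).clm_apply (by fun_prop)
    have h1 : ∫ t in (0 : ℝ)..(Real.pi / 2), F' (γ t) (γ' t) = F p.2 - F p.1 := by
      rw [intervalIntegral.integral_eq_sub_of_hasDerivAt (fun t _ => hder2 t)
        (hcont.intervalIntegrable _ _)]
      simp [hγ]
    rw [← h1]
    have h2 := sq_intervalIntegral_le hpi hcont
    rw [sub_zero] at h2
    exact h2
  have hprodI : Integrable (fun q : (E × E) × ℝ => G (ContinuousLinearMap.rotation q.2 q.1))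
      ((μ.prod μ).prod (volume.restrict (Set.uIoc 0 (Real.pi / 2)))) := by
    have : IsFiniteMeasure ((volume : Measure ℝ).restrict (Set.uIoc 0 (Real.pi / 2))) :=
      ⟨by simp [Set.uIoc_of_le hpi.le]⟩
    refine (hdom.comp_fst _).mono' (hGc.comp hRc).aestronglyMeasurable
      (Eventually.of_forall fun q => hGR q.1 q.2)
  have hswap : ∫ p, (∫ t in (0 : ℝ)..(Real.pi / 2), G (ContinuousLinearMap.rotation t p))
      ∂(μ.prod μ) = ∫ t in (0 : ℝ)..(Real.pi / 2),
        ∫ p, G (ContinuousLinearMap.rotation t p) ∂(μ.prod μ) := by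
    simp only [intervalIntegral.integral_of_le hpi.le]
    rw [Set.uIoc_of_le hpi.le] at hprodI
    exact integral_integral_swap hprodI
  have hinner : ∀ t, ∫ p, G (ContinuousLinearMap.rotation t p) ∂(μ.prod μ) ≤ V := by
    intro t
    have hGi : Integrable G (μ.prod μ) :=
      hdom.mono' hGc.aestronglyMeasurable (Eventually.of_forall fun p => by
        have := hGR p 0
        simpa [ContinuousLinearMap.rotation_apply] using this)
    rw [← integral_map (by fun_prop) hGc.aestronglyMeasurable (φ := ContinuousLinearMap.rotation t),
      hrot t, integral_prod _ hGi]
    calc ∫ x, ∫ y, G (x, y) ∂μ ∂μ ≤ ∫ _, V ∂μ :=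
          integral_mono hGi.integral_prod_left (integrable_const _) fun x => hV x
      _ = V := by simp
  have hRHS : Integrable (fun p => ∫ t in (0 : ℝ)..(Real.pi / 2),
      G (ContinuousLinearMap.rotation t p)) (μ.prod μ) := by
    simp only [intervalIntegral.integral_of_le hpi.le]
    rw [Set.uIoc_of_le hpi.le] at hprodI
    exact hprodI.integral_prod_left
  calc ∫ p : E × E, (F p.2 - F p.1) ^ 2 ∂(μ.prod μ)
      ≤ ∫ p, (Real.pi / 2) * (∫ t in (0 : ℝ)..(Real.pi / 2),
          G (ContinuousLinearMap.rotation t p)) ∂(μ.prod μ) :=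
        integral_mono_of_nonneg (Eventually.of_forall fun p => sq_nonneg _)
          (hRHS.const_mul _) (Eventually.of_forall hpt)
    _ = (Real.pi / 2) * ∫ t in (0 : ℝ)..(Real.pi / 2),
          ∫ p, G (ContinuousLinearMap.rotation t p) ∂(μ.prod μ) := by
        rw [integral_const_mul, hswap]
    _ ≤ (Real.pi / 2) * ((Real.pi / 2) * V) := by
        gcongr
        calc _ ≤ ∫ _ in (0 : ℝ)..(Real.pi / 2), V := by
              have hi : IntervalIntegrable (fun t =>
                  ∫ p, G (ContinuousLinearMap.rotation t p) ∂(μ.prod μ)) volume 0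
                  (Real.pi / 2) := by
                rw [intervalIntegrable_iff]
                exact hprodI.integral_prod_right
              exact intervalIntegral.integral_mono_on hpi.le hi
                (intervalIntegrable_const) fun t _ => hinner t
          _ = _ := by simp
    _ = _ := by ring

end Poincare

/-! ### Quadratic forms in transformed Gaussian vectors -/

section QuadraticForms

open scoped Matrix.Norms.L2Operator

/-- A continuously differentiable function can be approximated in `L²` by its products with smooth
cutoff functions, which are bounded with bounded derivative. -/
theorem exists_bounded_contDiff_approx {T : ℝ → ℝ} (hT : ContDiff ℝ 1 T) {γ : Measure ℝ}
    (hT2 : Integrable (fun t => T t ^ 2) γ) {η : ℝ} (hη : 0 < η) :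
    ∃ g : ℝ → ℝ, ContDiff ℝ 1 g ∧ (∃ B : ℝ, 0 < B ∧ ∀ t, |g t| ≤ B ∧ |deriv g t| ≤ B) ∧
      (∀ t, |g t| ≤ |T t|) ∧ ∫ t, (T t - g t) ^ 2 ∂γ ≤ η := by
  let χ : ℕ → ContDiffBump (0 : ℝ) := fun m => ⟨m + 1, m + 2, by positivity, by linarith⟩
  have hle : ∀ m t, |χ m t * T t| ≤ |T t| := by
    intro m t
    rw [abs_mul, abs_of_nonneg (χ m).nonneg]
    exact mul_le_of_le_one_left (abs_nonneg _) (χ m).le_one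
  have hlim : Tendsto (fun m => ∫ t, (T t - χ m t * T t) ^ 2 ∂γ) atTop (𝓝 (∫ _, (0 : ℝ) ∂γ)) := by
    refine tendsto_integral_of_dominated_convergence (fun t => T t ^ 2) (fun m => ?_) hT2
      (fun m => Eventually.of_forall fun t => ?_) (Eventually.of_forall fun t => ?_)
    · have h1 := hT.continuous
      have h2 := (χ m).continuous
      exact (by fun_prop : Continuous fun t => (T t - χ m t * T t) ^ 2).aestronglyMeasurable
    · rw [Real.norm_of_nonneg (sq_nonneg _),
        show T t - χ m t * T t = (1 - χ m t) * T t by ring, mul_pow]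
      refine mul_le_of_le_one_left (sq_nonneg _) ?_
      have h1 := (χ m).nonneg (x := t)
      have h2 := (χ m).le_one (x := t)
      nlinarith
    · refine tendsto_const_nhds.congr' ?_
      obtain ⟨m₀, hm₀⟩ := exists_nat_ge |t|
      filter_upwards [eventually_ge_atTop m₀] with m hm
      have : χ m t = 1 := by
        refine (χ m).one_of_mem_closedBall ?_
        rw [mem_closedBall_zero_iff, Real.norm_eq_abs]
        have : (m₀ : ℝ) ≤ m := by exact_mod_cast hm
        change |t| ≤ (m : ℝ) + 1
        linarith
      simp [this]
  rw [integral_zero] at hlim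
  obtain ⟨m, hm⟩ := (hlim.eventually_le_const hη).exists
  have hsupp : HasCompactSupport fun t => χ m t * T t := (χ m).hasCompactSupport.mul_right
  have hsmooth : ContDiff ℝ 1 fun t => χ m t * T t := (χ m).contDiff.mul hT
  obtain ⟨B₁, hB₁⟩ := hsupp.exists_bound_of_continuous hsmooth.continuous
  obtain ⟨B₂, hB₂⟩ := hsupp.deriv.exists_bound_of_continuous (hsmooth.continuous_deriv le_rfl)
  refine ⟨_, hsmooth, ⟨max (max B₁ B₂) 1, by positivity, fun t => ⟨?_, ?_⟩⟩, hle m, hm⟩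
  · exact (hB₁ t).trans ((le_max_left _ _).trans (le_max_left _ _))
  · exact (hB₂ t).trans ((le_max_right _ _).trans (le_max_left _ _))

/-- The mean absolute deviation is controlled by the mean squared difference of independent
copies. -/
theorem integral_abs_sub_integral_le {X : Type*} [MeasurableSpace X] (μ : Measure X)
    [IsProbabilityMeasure μ] {F : X → ℝ} (hFm : Measurable F) {C : ℝ} (hC : ∀ x, |F x| ≤ C)
    {t : ℝ} (ht : 0 < t) :
    ∫ x, |F x - ∫ y, F y ∂μ| ∂μ ≤
      (t + (∫ p : X × X, (F p.2 - F p.1) ^ 2 ∂(μ.prod μ)) / t) / 2 := by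
  have hFi : Integrable F μ := Integrable.of_bound hFm.aestronglyMeasurable C
    (Eventually.of_forall hC)
  have hprod : Integrable (fun p : X × X => (F p.2 - F p.1) ^ 2) (μ.prod μ) := by
    refine Integrable.of_bound (by fun_prop) ((2 * C) ^ 2) (Eventually.of_forall fun p => ?_)
    rw [Real.norm_of_nonneg (sq_nonneg _), ← sq_abs]
    refine pow_le_pow_left₀ (abs_nonneg _) ?_ 2
    linarith [abs_sub (F p.2) (F p.1), hC p.1, hC p.2]
  have hsec : ∀ x, Integrable (fun y => (F y - F x) ^ 2) μ := by
    intro x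
    refine Integrable.of_bound (by fun_prop) ((2 * C) ^ 2) (Eventually.of_forall fun y => ?_)
    rw [Real.norm_of_nonneg (sq_nonneg _), ← sq_abs]
    refine pow_le_pow_left₀ (abs_nonneg _) ?_ 2
    linarith [abs_sub (F y) (F x), hC x, hC y]
  have hpt : ∀ x, |F x - ∫ y, F y ∂μ| ≤ (t + (∫ y, (F y - F x) ^ 2 ∂μ) / t) / 2 := by
    intro x
    have e : F x - ∫ y, F y ∂μ = ∫ y, (F x - F y) ∂μ := by
      rw [integral_sub (integrable_const _) hFi]; simp
    rw [e]
    calc |∫ y, (F x - F y) ∂μ| ≤ ∫ y, |F x - F y| ∂μ := abs_integral_le_integral_abs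
      _ ≤ ∫ y, (t + (F y - F x) ^ 2 / t) / 2 ∂μ := by
          refine integral_mono ((integrable_const _).sub hFi).abs
            (((integrable_const _).add ((hsec x).div_const t)).div_const 2) fun y => ?_
          have h1 : 0 ≤ (t - |F x - F y|) ^ 2 / t := by positivity
          have h2 : (t - |F x - F y|) ^ 2 / t
              = t + (F y - F x) ^ 2 / t - 2 * |F x - F y| := by
            rw [← sq_abs (F y - F x), abs_sub_comm (F y)]; field_simp; ring
          linarith
      _ = _ := by
          rw [integral_div, integral_add (integrable_const _) ((hsec x).div_const t),
            integral_div]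
          simp
  have hout : Integrable (fun x => (t + (∫ y, (F y - F x) ^ 2 ∂μ) / t) / 2) μ :=
    (((integrable_const _).add (hprod.integral_prod_left.div_const t)).div_const 2)
  calc _ ≤ ∫ x, (t + (∫ y, (F y - F x) ^ 2 ∂μ) / t) / 2 ∂μ :=
        integral_mono ((hFi.sub (integrable_const _)).abs) hout hpt
    _ = _ := by
        rw [integral_div, integral_add (integrable_const _) (hprod.integral_prod_left.div_const t),
          integral_div, integral_prod _ hprod]
        simp

/-- The concentration of a quadratic form in a bounded smooth function of a centered Gaussian
vector: the mean squared difference of independent copies is of the order of the dimension. -/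
theorem integral_prod_quadForm_sub_sq_le {n : ℕ} (μ : Measure (Fin n → ℝ)) [IsGaussian μ]
    (hμ : ∀ L : StrongDual ℝ (Fin n → ℝ), μ[L] = 0) {M : ℝ} (hM : 0 ≤ M)
    (hcov : ∀ u : Fin n → ℝ, ∫ z, (u ⬝ᵥ z) ^ 2 ∂μ ≤ M * (u ⬝ᵥ u))
    {g : ℝ → ℝ} (hg : ContDiff ℝ 1 g) {B : ℝ} (hB : ∀ t, |g t| ≤ B ∧ |deriv g t| ≤ B)
    {A : Matrix (Fin n) (Fin n) ℝ} (hA : A.IsSymm) {K : ℝ} (hK : ‖A‖ ≤ K) :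
    ∫ p : (Fin n → ℝ) × (Fin n → ℝ),
      ((g ∘ p.2) ⬝ᵥ (A *ᵥ (g ∘ p.2)) - (g ∘ p.1) ⬝ᵥ (A *ᵥ (g ∘ p.1))) ^ 2 ∂(μ.prod μ) ≤
      (Real.pi / 2) ^ 2 * (M * (4 * B ^ 2 * (K ^ 2 * (n * B ^ 2)))) := by
  have hB0 : 0 ≤ B := (abs_nonneg _).trans (hB 0).1
  set u : (Fin n → ℝ) → Fin n → ℝ := fun z i => 2 * (A *ᵥ (g ∘ z)) i * deriv g (z i) with hu
  set F' : (Fin n → ℝ) → (Fin n → ℝ) →L[ℝ] ℝ := fun z =>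
    ∑ i, u z i • ContinuousLinearMap.proj (R := ℝ) (φ := fun _ : Fin n => ℝ) i with hF'
  have hF'app : ∀ z h, F' z h = u z ⬝ᵥ h := by
    intro z h
    simp [hF', dotProduct]
  have hgd : ∀ t, HasDerivAt g (deriv g t) t := fun t =>
    (hg.differentiable (by norm_num) t).hasDerivAt
  have hgc := hg.continuous
  have hg'c : Continuous (deriv g) := hg.continuous_deriv le_rfl
  have hder : ∀ z, HasFDerivAt (fun z : Fin n → ℝ => (g ∘ z) ⬝ᵥ (A *ᵥ (g ∘ z))) (F' z) z := by
    intro z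
    have h1 : ∀ i, HasFDerivAt (fun z : Fin n → ℝ => g (z i))
        (deriv g (z i) • ContinuousLinearMap.proj (R := ℝ) (φ := fun _ : Fin n => ℝ) i) z :=
      fun i => (hgd (z i)).comp_hasFDerivAt z (hasFDerivAt_apply i z)
    have h2 : HasFDerivAt (fun z : Fin n → ℝ => ∑ i, g (z i) * ∑ j, A i j * g (z j)) _ z :=
      HasFDerivAt.fun_sum fun i _ => (h1 i).mul
        (HasFDerivAt.fun_sum fun j _ => (h1 j).const_mul (A i j))
    refine h2.congr_fderiv ?_
    refine ContinuousLinearMap.ext fun h => ?_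
    rw [hF'app]
    simp only [_root_.sum_apply, _root_.add_apply, _root_.smul_apply,
      ContinuousLinearMap.proj_apply, smul_eq_mul,
      Finset.sum_add_distrib]
    have h3 : ∑ i, g (z i) * ∑ j, A i j * (deriv g (z j) * h j) =
        ∑ i, (∑ j, A i j * g (z j)) * (deriv g (z i) * h i) := by
      simp only [Finset.mul_sum, Finset.sum_mul]
      rw [Finset.sum_comm]
      refine Finset.sum_congr rfl fun i _ => Finset.sum_congr rfl fun j _ => ?_
      rw [hA.apply]; ring
    rw [h3, ← Finset.sum_add_distrib, dotProduct]
    refine Finset.sum_congr rfl fun i _ => ?_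
    simp only [hu, mulVec, dotProduct, Function.comp_apply]
    ring
  have huc : ∀ i, Continuous fun z => u z i := by
    intro i
    simp only [hu, mulVec, dotProduct, Function.comp_apply]
    fun_prop
  have hF'c : Continuous F' := by
    simp only [hF']
    exact continuous_finsetSum _ fun i _ => (huc i).smul continuous_const
  have hAg : ∀ z i, |(A *ᵥ (g ∘ z)) i| ≤ ∑ j, |A i j| * B := by
    intro z i
    change |∑ j, A i j * (g ∘ z) j| ≤ _
    refine (Finset.abs_sum_le_sum_abs _ _).trans
      (Finset.sum_le_sum fun j _ => ?_)
    rw [abs_mul]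
    exact mul_le_mul_of_nonneg_left (hB _).1 (abs_nonneg _)
  have hF'b : ∀ z, ‖F' z‖ ≤ ∑ i, 2 * (∑ j, |A i j| * B) * B := by
    intro z
    refine (norm_sum_le _ _).trans (Finset.sum_le_sum fun i _ => ?_)
    rw [norm_smul]
    have hp : ‖ContinuousLinearMap.proj (R := ℝ) (φ := fun _ : Fin n => ℝ) i‖ ≤ 1 :=
      ContinuousLinearMap.opNorm_le_bound _ zero_le_one fun v => by
        simpa using norm_le_pi_norm v i
    have h1 : ‖u z i‖ ≤ 2 * (∑ j, |A i j| * B) * B := by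
      simp only [hu, Real.norm_eq_abs, abs_mul, abs_two]
      have := hAg z i
      have := (hB (z i)).2
      gcongr
    calc _ ≤ ‖u z i‖ * 1 := by gcongr
      _ ≤ _ := by rw [mul_one]; exact h1
  refine integral_prod_sub_sq_le μ hμ hder hF'c hF'b fun z => ?_
  simp_rw [hF'app]
  refine (hcov _).trans ?_
  have hdot : u z ⬝ᵥ u z ≤ 4 * B ^ 2 * ((A *ᵥ (g ∘ z)) ⬝ᵥ (A *ᵥ (g ∘ z))) := by
    simp only [dotProduct, Finset.mul_sum, hu]
    refine Finset.sum_le_sum fun i _ => ?_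
    have h1 : deriv g (z i) ^ 2 ≤ B ^ 2 := by
      rw [← sq_abs]; exact pow_le_pow_left₀ (abs_nonneg _) (hB _).2 2
    nlinarith [mul_le_mul_of_nonneg_left h1 (sq_nonneg ((A *ᵥ (g ∘ z)) i))]
  have hgg : (g ∘ z) ⬝ᵥ (g ∘ z) ≤ n * B ^ 2 := by
    calc (g ∘ z) ⬝ᵥ (g ∘ z) ≤ ∑ _i : Fin n, B ^ 2 := by
          refine Finset.sum_le_sum fun i _ => ?_
          rw [← sq, ← sq_abs]
          exact pow_le_pow_left₀ (abs_nonneg _) (hB _).1 2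
      _ = _ := by simp
  have hAA := mulVec_dotProduct_mulVec_le A (g ∘ z)
  have h0 := dotProduct_self_nonneg' (g ∘ z)
  have hAA2 : (A *ᵥ (g ∘ z)) ⬝ᵥ (A *ᵥ (g ∘ z)) ≤ K ^ 2 * (n * B ^ 2) := by
    refine hAA.trans ?_
    gcongr
  gcongr
  exact hdot.trans (by gcongr)

/-- Weighted Cauchy–Schwarz inequality for a bilinear form. -/
theorem two_mul_abs_dotProduct_mulVec_le {n : ℕ} {A : Matrix (Fin n) (Fin n) ℝ} {K t : ℝ}
    (hK : ‖A‖ ≤ K) (hK0 : 0 < K) (ht : 0 < t) (v w : Fin n → ℝ) :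
    2 * |v ⬝ᵥ (A *ᵥ w)| ≤ K * (t * (v ⬝ᵥ v) + (w ⬝ᵥ w) / t) := by
  have hw : (A *ᵥ w) ⬝ᵥ (A *ᵥ w) / (K * t) ≤ K * ((w ⬝ᵥ w) / t) := by
    rw [div_le_iff₀ (by positivity)]
    have h0 := dotProduct_self_nonneg' w
    calc _ ≤ ‖A‖ ^ 2 * (w ⬝ᵥ w) := mulVec_dotProduct_mulVec_le A w
      _ ≤ K ^ 2 * (w ⬝ᵥ w) := by gcongr
      _ = _ := by field_simp
  have h1 := two_mul_dotProduct_le v (A *ᵥ w) (t := K * t) (by positivity)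
  have h2 := two_mul_dotProduct_le (-v) (A *ᵥ w) (t := K * t) (by positivity)
  rw [neg_dotProduct, neg_dotProduct_neg] at h2
  rcases abs_cases (v ⬝ᵥ (A *ᵥ w)) with h | h <;> rw [h.1] <;> linarith

end QuadraticForms

/-! ### A law of large numbers for quadratic forms in the transformed process -/

section TransformedProcess

open scoped Matrix.Norms.L2Operator

variable {d : ℕ} {Ω : Type*} [MeasurableSpace Ω] {P : Measure Ω}
  {Z : Loc d → Ω → ℝ} {kZ : Loc d → ℝ} {T : ℝ → ℝ}

theorem integrable_sq_gaussianReal (hT : Continuous T) {C : ℝ}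
    (hC : ∀ t, |T t| ≤ C * Real.exp (C * |t|)) (m : ℝ) (v : NNReal) :
    Integrable (fun t => T t ^ 2) (gaussianReal m v) := by
  have h1 := (integrable_exp_mul_gaussianReal (μ := m) (v := v) (2 * C)).add
    (integrable_exp_mul_gaussianReal (μ := m) (v := v) (-(2 * C)))
  refine (h1.const_mul (C ^ 2)).mono' (by fun_prop) (Eventually.of_forall fun t => ?_)
  rw [Real.norm_of_nonneg (sq_nonneg _), ← sq_abs]
  calc |T t| ^ 2 ≤ (C * Real.exp (C * |t|)) ^ 2 :=
        pow_le_pow_left₀ (abs_nonneg _) (hC t) 2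
    _ = C ^ 2 * Real.exp (2 * C * |t|) := by
        rw [mul_pow, ← Real.exp_nat_mul]; congr 2; push_cast; ring
    _ ≤ _ := by
        refine mul_le_mul_of_nonneg_left ?_ (sq_nonneg C)
        simp only [Pi.add_apply]
        have e1 := Real.exp_pos (2 * C * t)
        have e2 := Real.exp_pos (-(2 * C) * t)
        rcases abs_cases t with h | h <;> rw [h.1]
        · linarith
        · rw [mul_neg, ← neg_mul]; linarith

theorem map_eq_gaussianReal (hZ : IsGaussianProcess Z P)
    (hZcov : HasZeroMeanAndCovariance P Z kZ) (s : Loc d) :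
    P.map (Z s) = gaussianReal 0 (kZ 0).toNNReal := by
  have h := (hZ.hasGaussianLaw_eval s).map_eq_gaussianReal
  rw [hZcov.1 s, ← covariance_self (hZ.aemeasurable s), hZcov.2 s s, sub_self] at h
  exact h

theorem hasGaussianLaw_vector (hZ : IsGaussianProcess Z P) (x : ℕ → Loc d) (n : ℕ) :
    HasGaussianLaw (fun ω (i : Fin n) => Z (x i) ω) P := by
  have h := (hZ.comp_right fun i : Fin n => x i).hasGaussianLaw Finset.univ
  exact h.map (ContinuousLinearMap.pi fun i : Fin n =>
    ContinuousLinearMap.proj (R := ℝ)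
      (φ := fun _ : (Finset.univ : Finset (Fin n)) => ℝ) ⟨i, Finset.mem_univ i⟩)

theorem HasZeroMeanAndCovariance.neg_eq (hcov : HasZeroMeanAndCovariance P Z kZ) (s : Loc d) :
    kZ (-s) = kZ s := by
  have h1 := hcov.2 0 s
  have h2 := hcov.2 s 0
  rw [zero_sub] at h1
  rw [sub_zero] at h2
  rw [← h1, ← h2, covariance_comm]

theorem memLp_transformed (hZ : IsGaussianProcess Z P)
    (hZcov : HasZeroMeanAndCovariance P Z kZ) (hT : Continuous T)
    (hT2 : Integrable (fun t => T t ^ 2) (gaussianReal 0 (kZ 0).toNNReal)) (s : Loc d) :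
    MemLp (fun ω => T (Z s ω)) 2 P := by
  rw [← map_eq_gaussianReal hZ hZcov s] at hT2
  have h : MemLp T 2 (P.map (Z s)) :=
    (memLp_two_iff_integrable_sq hT.aestronglyMeasurable).2 hT2
  exact h.comp_of_map (hZ.aemeasurable s)

variable [IsProbabilityMeasure P]

theorem integral_mul_eq (hcov : HasZeroMeanAndCovariance P Z kZ) (h2 : ∀ s, MemLp (Z s) 2 P)
    (s t : Loc d) : ∫ ω, Z s ω * Z t ω ∂P = kZ (s - t) := by
  have h := covariance_eq_sub (h2 s) (h2 t)
  rw [hcov.2, hcov.1 s, zero_mul, sub_zero] at h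
  exact h.symm

/-- The expectation of a quadratic form. -/
theorem integral_quadForm (hcov : HasZeroMeanAndCovariance P Z kZ) (h2 : ∀ s, MemLp (Z s) 2 P)
    (x : ℕ → Loc d) {n : ℕ} (A : Matrix (Fin n) (Fin n) ℝ) :
    Integrable (fun ω => (fun i : Fin n => Z (x i) ω) ⬝ᵥ (A *ᵥ fun i : Fin n => Z (x i) ω)) P ∧
    ∫ ω, (fun i : Fin n => Z (x i) ω) ⬝ᵥ (A *ᵥ fun i : Fin n => Z (x i) ω) ∂P =
      (A * covMatrix kZ x n).trace := by
  have hI : ∀ i j : Fin n, Integrable (fun ω => A i j * (Z (x j) ω * Z (x i) ω)) P :=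
    fun i j => ((h2 (x j)).integrable_mul (h2 (x i))).const_mul _
  have e : ∀ ω, (fun i : Fin n => Z (x i) ω) ⬝ᵥ (A *ᵥ fun i : Fin n => Z (x i) ω) =
      ∑ i, ∑ j, A i j * (Z (x j) ω * Z (x i) ω) := by
    intro ω
    simp only [dotProduct, mulVec, Finset.mul_sum]
    exact Finset.sum_congr rfl fun i _ => Finset.sum_congr rfl fun j _ => by ring
  simp_rw [e]
  refine ⟨integrable_finsetSum _ fun i _ => integrable_finsetSum _ fun j _ => hI i j, ?_⟩
  rw [integral_finsetSum _ fun i _ => integrable_finsetSum _ fun j _ => hI i j]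
  simp_rw [integral_finsetSum _ fun j _ => hI _ j, integral_const_mul, integral_mul_eq hcov h2]
  simp [trace, Matrix.mul_apply, covMatrix]

theorem integral_dotProduct_self (hcov : HasZeroMeanAndCovariance P Z kZ)
    (h2 : ∀ s, MemLp (Z s) 2 P) (x : ℕ → Loc d) (n : ℕ) :
    Integrable (fun ω => (fun i : Fin n => Z (x i) ω) ⬝ᵥ fun i : Fin n => Z (x i) ω) P ∧
    ∫ ω, (fun i : Fin n => Z (x i) ω) ⬝ᵥ (fun i : Fin n => Z (x i) ω) ∂P = n * kZ 0 := by
  have h := integral_quadForm hcov h2 x (1 : Matrix (Fin n) (Fin n) ℝ)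
  simpa [trace, covMatrix] using h

/-- Quadratic forms in a smooth bounded transformation of the process concentrate around their
means, uniformly over symmetric matrices of bounded operator norm. -/
theorem exists_quadForm_bounded_concentration (hZ : IsGaussianProcess Z P)
    (hZcov : HasZeroMeanAndCovariance P Z kZ)
    (hdecay : ∃ C c : ℝ, 0 < c ∧ ∀ s, |kZ s| ≤ C * Real.exp (-c * ‖s‖))
    {x : ℕ → Loc d} (hx : WellSeparated x) {g : ℝ → ℝ} (hg : ContDiff ℝ 1 g) {B : ℝ}
    (hB : ∀ t, |g t| ≤ B ∧ |deriv g t| ≤ B) (K : ℝ) {ε : ℝ} (hε : 0 < ε) :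
    ∃ N : ℕ, 0 < N ∧ ∀ n ≥ N, ∀ A : Matrix (Fin n) (Fin n) ℝ, A.IsSymm → ‖A‖ ≤ K →
      Integrable (fun ω => (fun i : Fin n => g (Z (x i) ω)) ⬝ᵥ
        (A *ᵥ fun i : Fin n => g (Z (x i) ω))) P ∧
      ∫ ω, |(fun i : Fin n => g (Z (x i) ω)) ⬝ᵥ (A *ᵥ fun i : Fin n => g (Z (x i) ω)) -
        ∫ ω', (fun i : Fin n => g (Z (x i) ω')) ⬝ᵥ
          (A *ᵥ fun i : Fin n => g (Z (x i) ω')) ∂P| ∂P ≤ ε * n := by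
  obtain ⟨C, c, hc, hC⟩ := hdecay
  obtain ⟨b, hb, hnorm⟩ := exists_norm_covMatrix_le hx hc
  have hM := hnorm C kZ hZcov.neg_eq hC
  set M := C * b with hMdef
  have hM0 : 0 ≤ M := (norm_nonneg _).trans (hM 0)
  set D : ℝ := (Real.pi / 2) ^ 2 * (M * (4 * B ^ 2 * (K ^ 2 * B ^ 2))) with hD
  have hD0 : 0 ≤ D := by positivity
  obtain ⟨N, hN⟩ := exists_nat_gt (D / ε ^ 2)
  refine ⟨N + 1, by positivity, fun n hn A hA hAK => ?_⟩
  have hnpos : (0 : ℝ) < n := by exact_mod_cast (by omega : 0 < n)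
  have hnN : D / ε ^ 2 ≤ n := hN.le.trans (by exact_mod_cast (by omega : N ≤ n))
  have h2Z : ∀ s, MemLp (Z s) 2 P := fun s => (hZ.hasGaussianLaw_eval s).memLp_two
  have hvec := hasGaussianLaw_vector hZ x n
  have hae := hvec.aemeasurable
  set X : Ω → Fin n → ℝ := fun ω i => Z (x i) ω with hX
  set μ := P.map X with hμdef
  have hμG : IsGaussian μ := hvec.isGaussian_map
  have hcent : ∀ L : StrongDual ℝ (Fin n → ℝ), μ[L] = 0 := by
    intro L
    rw [hμdef, integral_map hae L.continuous.aestronglyMeasurable]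
    have e : ∀ ω, L (X ω) = ∑ i : Fin n, Z (x i) ω * L (Pi.single i 1) := by
      intro ω
      have h1 := L.toLinearMap.pi_apply_eq_sum_univ (X ω)
      simp only [ContinuousLinearMap.coe_coe, smul_eq_mul] at h1
      rw [h1]
      refine Finset.sum_congr rfl fun i _ => ?_
      congr 2
      ext j
      simp [Pi.single_apply, eq_comm]
    simp_rw [e]
    rw [integral_finsetSum _ fun (i : Fin n) _ =>
      ((h2Z (x i)).integrable (by norm_num)).mul_const _]
    simp [integral_mul_const, hZcov.1]
  have hcov : ∀ u : Fin n → ℝ, ∫ z, (u ⬝ᵥ z) ^ 2 ∂μ ≤ M * (u ⬝ᵥ u) := by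
    intro u
    have hm : AEStronglyMeasurable (fun z : Fin n → ℝ => (u ⬝ᵥ z) ^ 2) (P.map X) := by
      have : Continuous fun z : Fin n → ℝ => (u ⬝ᵥ z) ^ 2 := by unfold dotProduct; fun_prop
      exact this.aestronglyMeasurable
    rw [hμdef, integral_map hae hm]
    have e : ∀ ω, (u ⬝ᵥ X ω) ^ 2 = X ω ⬝ᵥ (vecMulVec u u *ᵥ X ω) := by
      intro ω
      rw [vecMulVec_mulVec, sq]
      simp [dotProduct_smul, dotProduct_comm]
    simp_rw [e]
    rw [(integral_quadForm hZcov h2Z x (vecMulVec u u)).2, trace_mul_comm, mul_vecMulVec,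
      trace_vecMulVec, dotProduct_comm]
    refine (le_abs_self _).trans ((abs_dotProduct_mulVec_le _ _).trans ?_)
    exact mul_le_mul_of_nonneg_right (hM n) (dotProduct_self_nonneg' u)
  set F : (Fin n → ℝ) → ℝ := fun z => (g ∘ z) ⬝ᵥ (A *ᵥ (g ∘ z)) with hF
  have hFc : Continuous F := by
    have := hg.continuous
    simp only [hF, dotProduct, mulVec, Function.comp_apply]
    fun_prop
  have hB0 : 0 ≤ B := (abs_nonneg _).trans (hB 0).1
  have hFb : ∀ z, |F z| ≤ ∑ i, ∑ j, B * (|A i j| * B) := by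
    intro z
    simp only [hF, dotProduct, mulVec, Finset.mul_sum, Function.comp_apply]
    refine (Finset.abs_sum_le_sum_abs _ _).trans (Finset.sum_le_sum fun i _ => ?_)
    refine (Finset.abs_sum_le_sum_abs _ _).trans (Finset.sum_le_sum fun j _ => ?_)
    rw [abs_mul, abs_mul]
    have h1 := (hB (z i)).1
    have h2 := (hB (z j)).1
    gcongr
  have hvar := integral_prod_quadForm_sub_sq_le μ hcent hM0 hcov hg hB hA hAK
  -- the mean squared difference is at most `D * n`, hence at most `(ε * n) ^ 2` for large `n`, which
  -- explains the weight `ε * n`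
  have hconc := integral_abs_sub_integral_le μ hFc.measurable hFb (t := ε * n) (by positivity)
  have htr : ∀ {f : (Fin n → ℝ) → ℝ}, Continuous f → ∫ z, f z ∂μ = ∫ ω, f (X ω) ∂P :=
    fun hf => integral_map hae hf.aestronglyMeasurable
  refine ⟨?_, ?_⟩
  · have : Integrable F μ := Integrable.of_bound hFc.aestronglyMeasurable _
      (Eventually.of_forall hFb)
    exact this.comp_aemeasurable hae
  · rw [htr (f := fun z => |F z - ∫ y, F y ∂μ|) (by fun_prop), htr hFc] at hconc
    refine hconc.trans ?_
    have h3 : (∫ p : (Fin n → ℝ) × (Fin n → ℝ), (F p.2 - F p.1) ^ 2 ∂(μ.prod μ)) / (ε * n)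
        ≤ ε * n := by
      rw [div_le_iff₀ (by positivity)]
      refine hvar.trans ?_
      rw [div_le_iff₀ (by positivity)] at hnN
      have : (Real.pi / 2) ^ 2 * (M * (4 * B ^ 2 * (K ^ 2 * (n * B ^ 2)))) = D * n := by
        rw [hD]; ring
      rw [this]
      nlinarith
    linarith

/-- Quadratic forms in the transformed process concentrate around their means, uniformly over
symmetric matrices of bounded operator norm. The transformation is replaced by a bounded smooth one
at a cost that is small in mean square. -/
theorem exists_quadForm_concentration (hZ : IsGaussianProcess Z P)
    (hZcov : HasZeroMeanAndCovariance P Z kZ)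
    (hdecay : ∃ C c : ℝ, 0 < c ∧ ∀ s, |kZ s| ≤ C * Real.exp (-c * ‖s‖))
    {x : ℕ → Loc d} (hx : WellSeparated x) (hT : ContDiff ℝ 1 T)
    (hT2 : Integrable (fun t => T t ^ 2) (gaussianReal 0 (kZ 0).toNNReal))
    {K : ℝ} (hK : 0 < K) {ε : ℝ} (hε : 0 < ε) :
    ∃ N : ℕ, 0 < N ∧ ∀ n ≥ N, ∀ A : Matrix (Fin n) (Fin n) ℝ, A.IsSymm → ‖A‖ ≤ K →
      ∫ ω, |(fun i : Fin n => T (Z (x i) ω)) ⬝ᵥ (A *ᵥ fun i : Fin n => T (Z (x i) ω)) -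
        ∫ ω', (fun i : Fin n => T (Z (x i) ω')) ⬝ᵥ
          (A *ᵥ fun i : Fin n => T (Z (x i) ω')) ∂P| ∂P ≤ ε * n := by
  set γ := gaussianReal 0 (kZ 0).toNNReal with hγ
  set m₂ : ℝ := ∫ t, T t ^ 2 ∂γ with hm₂
  have hm₂0 : 0 ≤ m₂ := integral_nonneg fun t => sq_nonneg _
  -- the weight and the accuracy that make each of the two parts of the truncation error at most `ε / 8`
  set t : ℝ := 16 * K * (m₂ + 1) / ε with ht
  have ht0 : 0 < t := by positivity
  set η : ℝ := ε / (4 * K * t) with hη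
  have hη0 : 0 < η := by positivity
  obtain ⟨g, hg, ⟨B, -, hB⟩, hgT, hgη⟩ := exists_bounded_contDiff_approx hT hT2 hη0
  obtain ⟨N, hN0, hN⟩ := exists_quadForm_bounded_concentration hZ hZcov hdecay hx hg hB K
    (half_pos hε)
  refine ⟨N, hN0, fun n hn A hA hAK => ?_⟩
  obtain ⟨hIg, hconc⟩ := hN n hn A hA hAK
  have hTc := hT.continuous
  have hgc := hg.continuous
  have hTm : ∀ s, MemLp (fun ω => T (Z s ω)) 2 P :=
    memLp_transformed hZ hZcov hT.continuous hT2
  set y : Ω → Fin n → ℝ := fun ω i => T (Z (x i) ω) with hy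
  set w : Ω → Fin n → ℝ := fun ω i => g (Z (x i) ω) with hw
  have hgm : ∀ i : Fin n, MemLp (fun ω => g (Z (x i) ω)) 2 P := fun i =>
    (hTm (x i)).mono (hg.continuous.comp_aestronglyMeasurable
      (hZ.aemeasurable (x i)).aestronglyMeasurable) (Eventually.of_forall fun ω => hgT _)
  have hdiffm : ∀ i : Fin n, MemLp (fun ω => T (Z (x i) ω) - g (Z (x i) ω)) 2 P :=
    fun i => (hTm (x i)).sub (hgm i)
  have hsqT : ∀ i : Fin n, ∫ ω, T (Z (x i) ω) ^ 2 ∂P = m₂ := by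
    intro i
    rw [hm₂, hγ, ← map_eq_gaussianReal hZ hZcov (x i), integral_map (hZ.aemeasurable _)
      (by fun_prop : Continuous fun t => T t ^ 2).aestronglyMeasurable]
  have hsqD : ∀ i : Fin n, ∫ ω, (T (Z (x i) ω) - g (Z (x i) ω)) ^ 2 ∂P ≤ η := by
    intro i
    rw [hγ, ← map_eq_gaussianReal hZ hZcov (x i), integral_map (hZ.aemeasurable _)
      (by fun_prop : Continuous fun t => (T t - g t) ^ 2).aestronglyMeasurable] at hgη
    exact hgη
  have hQI : Integrable (fun ω => y ω ⬝ᵥ (A *ᵥ y ω)) P := by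
    simp only [dotProduct, mulVec, Finset.mul_sum]
    refine integrable_finsetSum _ fun i _ => integrable_finsetSum _ fun j _ => ?_
    have := ((hTm (x i)).integrable_mul (hTm (x j))).const_mul (A i j)
    refine this.congr (Eventually.of_forall fun ω => ?_)
    simp only [hy, Pi.mul_apply]; ring
  have hpt : ∀ ω, |y ω ⬝ᵥ (A *ᵥ y ω) - w ω ⬝ᵥ (A *ᵥ w ω)| ≤
      ∑ i : Fin n, (K / 2) * (t * (T (Z (x i) ω) - g (Z (x i) ω)) ^ 2 + 4 / t * T (Z (x i) ω) ^ 2) := by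
    intro ω
    have hsw : y ω ⬝ᵥ (A *ᵥ w ω) = w ω ⬝ᵥ (A *ᵥ y ω) := by
      rw [dotProduct_mulVec, ← mulVec_transpose, hA.eq, dotProduct_comm]
    have e : y ω ⬝ᵥ (A *ᵥ y ω) - w ω ⬝ᵥ (A *ᵥ w ω)
        = (y ω - w ω) ⬝ᵥ (A *ᵥ (y ω + w ω)) := by
      rw [mulVec_add, dotProduct_add, sub_dotProduct, sub_dotProduct, hsw]; ring
    have h1 := two_mul_abs_dotProduct_mulVec_le hAK hK ht0 (y ω - w ω) (y ω + w ω)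
    rw [e]
    have h2 : (y ω + w ω) ⬝ᵥ (y ω + w ω) ≤ ∑ i : Fin n, 4 * T (Z (x i) ω) ^ 2 := by
      refine Finset.sum_le_sum fun i _ => ?_
      simp only [Pi.add_apply, hy, hw]
      have h3 : g (Z (x i) ω) ^ 2 ≤ T (Z (x i) ω) ^ 2 := sq_le_sq.2 (hgT _)
      nlinarith [sq_nonneg (T (Z (x i) ω) - g (Z (x i) ω))]
    have h4 : (y ω - w ω) ⬝ᵥ (y ω - w ω) = ∑ i : Fin n, (T (Z (x i) ω) - g (Z (x i) ω)) ^ 2 := by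
      simp [dotProduct, hy, hw, sq]
    have h5 : ((y ω + w ω) ⬝ᵥ (y ω + w ω)) / t ≤ (∑ i : Fin n, 4 * T (Z (x i) ω) ^ 2) / t := by
      gcongr
    rw [← Finset.mul_sum, Finset.sum_add_distrib, ← Finset.mul_sum, ← Finset.mul_sum]
    rw [h4] at h1
    rw [← Finset.mul_sum] at h5
    have h6 := mul_le_mul_of_nonneg_left h5 hK.le
    have h7 : (4 * ∑ i : Fin n, T (Z (x i) ω) ^ 2) / t = 4 / t * ∑ i : Fin n, T (Z (x i) ω) ^ 2 := by
      ring
    rw [h7] at h6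
    nlinarith
  have hsumI : ∀ i : Fin n, Integrable (fun ω => (K / 2) *
      (t * (T (Z (x i) ω) - g (Z (x i) ω)) ^ 2 + 4 / t * T (Z (x i) ω) ^ 2)) P := fun i =>
    (((hdiffm i).integrable_sq.const_mul t).add
      ((hTm (x i)).integrable_sq.const_mul (4 / t))).const_mul _
  have herr : ∫ ω, |y ω ⬝ᵥ (A *ᵥ y ω) - w ω ⬝ᵥ (A *ᵥ w ω)| ∂P ≤ ε / 4 * n := by
    calc _ ≤ ∫ ω, ∑ i : Fin n, (K / 2) *
          (t * (T (Z (x i) ω) - g (Z (x i) ω)) ^ 2 + 4 / t * T (Z (x i) ω) ^ 2) ∂P :=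
          integral_mono (hQI.sub hIg).abs (integrable_finsetSum _ fun i _ => hsumI i) hpt
      _ = ∑ i : Fin n, (K / 2) * (t * ∫ ω, (T (Z (x i) ω) - g (Z (x i) ω)) ^ 2 ∂P +
            4 / t * ∫ ω, T (Z (x i) ω) ^ 2 ∂P) := by
          rw [integral_finsetSum _ fun i _ => hsumI i]
          refine Finset.sum_congr rfl fun i _ => ?_
          rw [integral_const_mul, integral_add ((hdiffm i).integrable_sq.const_mul t)
            ((hTm (x i)).integrable_sq.const_mul (4 / t)), integral_const_mul, integral_const_mul]
      _ ≤ ∑ _i : Fin n, ε / 4 := by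
          refine Finset.sum_le_sum fun i _ => ?_
          rw [hsqT i]
          have h1 : K / 2 * (t * η) = ε / 8 := by rw [hη]; field_simp; norm_num
          have h2 : K / 2 * (4 / t * m₂) ≤ ε / 8 := by
            rw [ht]; field_simp; linarith
          have h3 : K / 2 * (t * ∫ ω, (T (Z (x i) ω) - g (Z (x i) ω)) ^ 2 ∂P) ≤ K / 2 * (t * η) := by
            gcongr
            exact hsqD i
          linarith
      _ = _ := by simp; ring
  have hmean : |∫ ω, w ω ⬝ᵥ (A *ᵥ w ω) ∂P - ∫ ω, y ω ⬝ᵥ (A *ᵥ y ω) ∂P| ≤ ε / 4 * n := by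
    rw [abs_sub_comm, ← integral_sub hQI hIg]
    exact abs_integral_le_integral_abs.trans herr
  set a := ∫ ω, y ω ⬝ᵥ (A *ᵥ y ω) ∂P
  set a' := ∫ ω, w ω ⬝ᵥ (A *ᵥ w ω) ∂P
  have hI1 : Integrable (fun ω => |y ω ⬝ᵥ (A *ᵥ y ω) - w ω ⬝ᵥ (A *ᵥ w ω)|) P :=
    (hQI.sub hIg).abs
  have hI2 : Integrable (fun ω => |w ω ⬝ᵥ (A *ᵥ w ω) - a'|) P :=
    (hIg.sub (integrable_const _)).abs
  have hI12 : Integrable (fun ω => |y ω ⬝ᵥ (A *ᵥ y ω) - w ω ⬝ᵥ (A *ᵥ w ω)| +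
      |w ω ⬝ᵥ (A *ᵥ w ω) - a'|) P := hI1.add hI2
  calc ∫ ω, |y ω ⬝ᵥ (A *ᵥ y ω) - a| ∂P ≤ ∫ ω, (|y ω ⬝ᵥ (A *ᵥ y ω) - w ω ⬝ᵥ (A *ᵥ w ω)| +
          |w ω ⬝ᵥ (A *ᵥ w ω) - a'| + |a' - a|) ∂P := by
        refine integral_mono (hQI.sub (integrable_const _)).abs
          (hI12.add (integrable_const _)) fun ω => ?_
        refine le_trans (le_of_eq ?_) (abs_add_three _ _ _)
        congr 1; ring
    _ = (∫ ω, |y ω ⬝ᵥ (A *ᵥ y ω) - w ω ⬝ᵥ (A *ᵥ w ω)| ∂P) +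
          (∫ ω, |w ω ⬝ᵥ (A *ᵥ w ω) - a'| ∂P) + |a' - a| := by
        rw [integral_add hI12 (integrable_const _), integral_add hI1 hI2]
        simp
    _ ≤ ε / 4 * n + ε / 2 * n + ε / 4 * n := add_le_add (add_le_add herr hconc) hmean
    _ = ε * n := by ring

end TransformedProcess

/-! ### Uniform properties of the correlation model -/

section Model

open scoped Matrix.Norms.L2Operator

variable {d q : ℕ} {σ₁ σ₂ : ℝ} {S : Set (EuclideanSpace ℝ (Fin q))}
  {c : EuclideanSpace ℝ (Fin q) → Loc d → ℝ} {x : ℕ → Loc d}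

theorem exists_abs_corr_le (h₁ : 0 < σ₁) (h₁₂ : σ₁ ≤ σ₂)
    (hsmooth : SmoothFamily (paramSet σ₁ σ₂ S) (covFamily c)) :
    ∃ C e : ℝ, 0 < e ∧ ∀ ψ ∈ S, ∀ s, |c ψ s| ≤ C * Real.exp (-e * ‖s‖) := by
  obtain ⟨-, ⟨C, e, he, hC⟩, -⟩ := hsmooth
  refine ⟨C / σ₁, e, he, fun ψ hψ s => ?_⟩
  have h := hC (consParam σ₁ ψ) (consParam_mem ⟨le_rfl, h₁₂⟩ hψ) s
  rw [covFamily_consParam, abs_mul, abs_of_pos h₁] at h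
  rw [div_mul_eq_mul_div, le_div_iff₀ h₁]
  linarith

theorem integrable_corr (h₁ : 0 < σ₁) (h₁₂ : σ₁ ≤ σ₂)
    (hfourier : PositiveFourierFamily (paramSet σ₁ σ₂ S) (covFamily c))
    {ψ : EuclideanSpace ℝ (Fin q)} (hψ : ψ ∈ S) : Integrable (c ψ) := by
  have h : Integrable (covFamily c (consParam σ₁ ψ)) :=
    integrable_of_fourierTransform_ne_zero fun h => by
      have := (hfourier.2 _ (consParam_mem ⟨le_rfl, h₁₂⟩ hψ) 0).2
      simp [h] at this
  refine (h.const_mul σ₁⁻¹).congr (Eventually.of_forall fun s => ?_)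
  simp only [covFamily_consParam]
  field_simp

theorem continuousWithinAt_corr (h₁ : 0 < σ₁) (h₁₂ : σ₁ ≤ σ₂)
    (hsmooth : SmoothFamily (paramSet σ₁ σ₂ S) (covFamily c))
    {ψ : EuclideanSpace ℝ (Fin q)} (hψ : ψ ∈ S) (s : Loc d) :
    ContinuousWithinAt (fun η => c η s) S ψ := by
  have h := (hsmooth.1 s _ (consParam_mem ⟨le_rfl, h₁₂⟩ hψ)).continuousAt
  have h2 : ContinuousAt (fun η => covFamily c (consParam σ₁ η) s) ψ :=
    ContinuousAt.comp (f := consParam σ₁) h (continuous_consParam σ₁).continuousAt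
  refine ContinuousAt.continuousWithinAt ((h2.const_mul σ₁⁻¹).congr
    (Eventually.of_forall fun η => ?_))
  simp only [covFamily_consParam]
  field_simp

/-- The correlation matrices of the model are well conditioned, uniformly. -/
theorem exists_wellConditioned (h₁ : 0 < σ₁) (h₁₂ : σ₁ ≤ σ₂) (hS : IsCompact S)
    (hc : ∀ ψ ∈ S, IsStationaryCorrelationFunction (c ψ))
    (hsmooth : SmoothFamily (paramSet σ₁ σ₂ S) (covFamily c))
    (hfourier : PositiveFourierFamily (paramSet σ₁ σ₂ S) (covFamily c))
    (hx : WellSeparated x) :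
    ∃ l M : ℝ, 0 < l ∧ 0 < M ∧ ∀ ψ ∈ S, ∀ n, WellConditioned l M (covMatrix (c ψ) x n) := by
  obtain ⟨C, e, he, hC⟩ := exists_abs_corr_le h₁ h₁₂ hsmooth
  obtain ⟨B, hB, hnorm⟩ := exists_norm_covMatrix_le hx he
  have hsub : consParam σ₁ '' S ⊆ paramSet σ₁ σ₂ S := by
    rintro _ ⟨ψ, hψ, rfl⟩
    exact consParam_mem ⟨le_rfl, h₁₂⟩ hψ
  have hcov : ∀ ψ ∈ S, IsStationaryCovarianceFunction (covFamily c (consParam σ₁ ψ)) := by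
    intro ψ hψ n y
    have := ((hc ψ hψ).1 n y).smul h₁.le
    convert! this using 1
  obtain ⟨l, hl, hlow⟩ := exists_lower_bound (Θ := consParam σ₁ '' S) (k := covFamily c)
    (hS.image (continuous_consParam σ₁))
    (by rintro _ ⟨ψ, hψ, rfl⟩; exact hcov ψ hψ)
    ⟨hfourier.1.mono (Set.prod_mono hsub le_rfl), fun θ hθ => hfourier.2 θ (hsub hθ)⟩ hx
  refine ⟨l / σ₁, max (C * B) 1, by positivity, by positivity, fun ψ hψ n => ⟨?_, ?_, ?_⟩⟩
  · exact covMatrix_isSymm (hc ψ hψ).1 x n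
  · intro v
    have h := hlow _ ⟨ψ, hψ, rfl⟩ n v
    have e2 : covMatrix (covFamily c (consParam σ₁ ψ)) x n = σ₁ • covMatrix (c ψ) x n := rfl
    rw [e2, smul_mulVec, dotProduct_smul, smul_eq_mul] at h
    rw [div_mul_eq_mul_div, div_le_iff₀ h₁]
    linarith
  · exact (hnorm C (c ψ) (hc ψ hψ).1.neg_eq (hC ψ hψ) n).trans (le_max_left _ _)

/-- The correlation matrices depend continuously on the parameter in operator norm, uniformly in
the number of locations. -/
theorem exists_norm_covMatrix_sub_le (h₁ : 0 < σ₁) (h₁₂ : σ₁ ≤ σ₂)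
    (hc : ∀ ψ ∈ S, IsStationaryCorrelationFunction (c ψ))
    (hreg : HasShortPaths S ∨ ∀ ψ ∈ S, Continuous (c ψ))
    (hsmooth : SmoothFamily (paramSet σ₁ σ₂ S) (covFamily c))
    (hfourier : PositiveFourierFamily (paramSet σ₁ σ₂ S) (covFamily c))
    (hx : WellSeparated x) {ψ : EuclideanSpace ℝ (Fin q)} (hψ : ψ ∈ S) {ε : ℝ} (hε : 0 < ε) :
    ∃ δ : ℝ, 0 < δ ∧ ∀ ψ' ∈ S, ‖ψ' - ψ‖ < δ →
      ∀ n, ‖covMatrix (c ψ') x n - covMatrix (c ψ) x n‖ ≤ ε := by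
  obtain ⟨C, e, he, hC⟩ := exists_abs_corr_le h₁ h₁₂ hsmooth
  obtain ⟨B, hB, hnorm⟩ := exists_norm_covMatrix_le hx (half_pos he)
  have hC1 : 1 ≤ C := by
    have := hC ψ hψ 0
    rwa [(hc ψ hψ).2, abs_one, norm_zero, mul_zero, Real.exp_zero, mul_one] at this
  have huni : ∀ ε : ℝ, 0 < ε →
      ∃ δ : ℝ, 0 < δ ∧ ∀ ψ' ∈ S, ‖ψ' - ψ‖ < δ → ∀ s, |c ψ' s - c ψ s| ≤ ε := by
    intro ε hε
    rcases hreg with hpath | hcont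
    · exact exists_abs_sub_le_of_shortPaths h₁ h₁₂ hpath hsmooth hψ hε
    · exact exists_abs_sub_le_of_continuous hc (fun ψ hψ => integrable_corr h₁ h₁₂ hfourier hψ)
        (fun ψ hψ => continuousWithinAt_corr h₁ h₁₂ hsmooth hψ) he hC hψ (hcont ψ hψ) hε
  obtain ⟨δ, hδ, h⟩ := huni ((ε / B) ^ 2 / (2 * C)) (by positivity)
  refine ⟨δ, hδ, fun ψ' hψ' hlt n => ?_⟩
  -- interpolation between the uniform bound and the exponential decay of the difference
  have hdec : ∀ s, |c ψ' s - c ψ s| ≤ ε / B * Real.exp (-(e / 2) * ‖s‖) := by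
    intro s
    have b1 := h ψ' hψ' hlt s
    have b2 : |c ψ' s - c ψ s| ≤ 2 * C * Real.exp (-e * ‖s‖) := by
      have := abs_sub (c ψ' s) (c ψ s)
      linarith [hC ψ' hψ' s, hC ψ hψ s]
    refine le_of_sq_le_sq ?_ (by positivity)
    calc |c ψ' s - c ψ s| ^ 2 = |c ψ' s - c ψ s| * |c ψ' s - c ψ s| := sq _
      _ ≤ ((ε / B) ^ 2 / (2 * C)) * (2 * C * Real.exp (-e * ‖s‖)) := by gcongr
      _ = (ε / B) ^ 2 * Real.exp (-e * ‖s‖) := by field_simp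
      _ = _ := by
        rw [mul_pow, ← Real.exp_nat_mul]
        congr 2; push_cast; ring
  have e2 : covMatrix (c ψ') x n - covMatrix (c ψ) x n
      = covMatrix (fun s => c ψ' s - c ψ s) x n := rfl
  rw [e2]
  refine (hnorm (ε / B) _ (fun s => ?_) hdec n).trans (le_of_eq (by field_simp))
  rw [(hc ψ hψ).1.neg_eq, (hc ψ' hψ').1.neg_eq]

/-- Finitely many parameters approximate the matrices of the cross validation criterion uniformly
in the parameter and the number of locations. -/
theorem exists_finset_norm_cvMat_sub_le (h₁ : 0 < σ₁) (h₁₂ : σ₁ ≤ σ₂) (hS : IsCompact S)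
    (hc : ∀ ψ ∈ S, IsStationaryCorrelationFunction (c ψ))
    (hreg : HasShortPaths S ∨ ∀ ψ ∈ S, Continuous (c ψ))
    (hsmooth : SmoothFamily (paramSet σ₁ σ₂ S) (covFamily c))
    (hfourier : PositiveFourierFamily (paramSet σ₁ σ₂ S) (covFamily c))
    (hx : WellSeparated x) {η : ℝ} (hη : 0 < η) :
    ∃ t : Finset (EuclideanSpace ℝ (Fin q)), (∀ ψ ∈ t, ψ ∈ S) ∧ ∀ ψ ∈ S, ∃ ψ' ∈ t, ∀ n,
      ‖cvMat (covMatrix (c ψ) x n) - cvMat (covMatrix (c ψ') x n)‖ ≤ η := by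
  obtain ⟨l, M, hl, hM, hwell⟩ := exists_wellConditioned h₁ h₁₂ hS hc hsmooth hfourier hx
  obtain ⟨K, hK, hLip⟩ := exists_norm_cvMat_sub_le hl hM
  choose! δ hδ hclose using fun ψ (hψ : ψ ∈ S) =>
    exists_norm_covMatrix_sub_le h₁ h₁₂ hc hreg hsmooth hfourier hx hψ (div_pos hη hK)
  obtain ⟨t, htS, hcover⟩ := hS.elim_nhds_subcover (fun ψ => Metric.ball ψ (δ ψ))
    fun ψ hψ => Metric.ball_mem_nhds ψ (hδ ψ hψ)
  refine ⟨t, htS, fun ψ hψ => ?_⟩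
  obtain ⟨ψ', hψ', hball⟩ := Set.mem_iUnion₂.1 (hcover hψ)
  refine ⟨ψ', hψ', fun n => ?_⟩
  rw [mem_ball_iff_norm] at hball
  calc _ ≤ K * ‖covMatrix (c ψ) x n - covMatrix (c ψ') x n‖ :=
        hLip n _ _ (hwell ψ hψ n) (hwell ψ' (htS ψ' hψ') n)
    _ ≤ K * (η / K) := by
        gcongr
        exact hclose ψ' (htS ψ' hψ') ψ hψ hball n
    _ = η := by field_simp

/-- Global identifiability separates the expected criterion at remote parameters from its value at
the true parameter. -/
theorem exists_trace_cvMat_gap (h₁ : 0 < σ₁) (h₁₂ : σ₁ ≤ σ₂) (hS : IsCompact S)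
    (hc : ∀ ψ ∈ S, IsStationaryCorrelationFunction (c ψ))
    (hsmooth : SmoothFamily (paramSet σ₁ σ₂ S) (covFamily c))
    (hfourier : PositiveFourierFamily (paramSet σ₁ σ₂ S) (covFamily c))
    (hx : WellSeparated x) {ψ₀ : EuclideanSpace ℝ (Fin q)} (hψ₀ : ψ₀ ∈ S)
    (hident : GloballyIdentifiable S c x ψ₀) {α : ℝ} (hα : 0 < α) :
    ∃ τ : ℝ, 0 < τ ∧ ∀ᶠ n : ℕ in atTop, ∀ ψ ∈ S, α ≤ ‖ψ - ψ₀‖ →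
      τ * n ≤ (cvMat (covMatrix (c ψ) x n) * covMatrix (c ψ₀) x n).trace -
        (cvMat (covMatrix (c ψ₀) x n) * covMatrix (c ψ₀) x n).trace := by
  obtain ⟨l, M, hl, hM, hwell⟩ := exists_wellConditioned h₁ h₁₂ hS hc hsmooth hfourier hx
  obtain ⟨K, hK, hfrob⟩ := exists_frobSq_sub_le hl hM
  obtain ⟨r, hr0, hr⟩ := ENNReal.lt_iff_exists_nnreal_btwn.1 (hident α hα)
  have hrpos : 0 < (r : ℝ) := by exact_mod_cast hr0
  have hdiag : ∀ ψ ∈ S, ∀ n, ∀ i, covMatrix (c ψ) x n i i = 1 := by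
    intro ψ hψ n i
    rw [covMatrix, of_apply, sub_self, (hc ψ hψ).2]
  refine ⟨l * (r / K), by positivity, ?_⟩
  filter_upwards [eventually_lt_of_lt_liminf hr, eventually_gt_atTop 0] with n hn hn0 ψ hψ hα'
  have hnpos : (0 : ℝ) < n := by exact_mod_cast hn0
  have h1 := hn.trans_le (iInf₂_le ψ ⟨hψ, hα'⟩)
  rw [ENNReal.lt_ofReal_iff_toReal_lt ENNReal.coe_ne_top, ENNReal.coe_toReal] at h1
  have h2 : (r : ℝ) * n ≤ frobSq (covMatrix (c ψ) x n - covMatrix (c ψ₀) x n) := by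
    rw [one_div, ← div_eq_inv_mul, lt_div_iff₀ hnpos] at h1
    exact h1.le
  have h3 := hfrob n _ _ (hwell ψ hψ n) (hwell ψ₀ hψ₀ n) (hdiag ψ hψ n) (hdiag ψ₀ hψ₀ n)
  refine le_trans ?_ (trace_cvMat_sub_ge (hwell ψ hψ n) (hwell ψ₀ hψ₀ n) hl hM)
  rw [mul_assoc]
  gcongr
  rw [div_mul_eq_mul_div, div_le_iff₀ hK]
  linarith

end Model

/-! ### Consistency of the cross validation estimator -/

section Consistency

open scoped Matrix.Norms.L2Operator

/-- The bound behind the consistency of a minimizer of a random criterion `Q`: if the mean of `Q`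
at `ψ` exceeds its mean at `ψ₀` by `g`, but `Q` does not, then `g` is at most the sum of the
fluctuations of `Q` over a finite net and at `ψ₀`, up to the discretization errors. -/
theorem gap_le_of_net {E : Type*} {Q e : E → ℝ} {t : Finset E} {ψ ψ' ψ₀ : E} {a b g : ℝ}
    (hψ' : ψ' ∈ t) (hgap : g ≤ e ψ - e ψ₀) (hQ : Q ψ ≤ Q ψ₀)
    (ha : |Q ψ - Q ψ'| ≤ a) (hb : |e ψ - e ψ'| ≤ b) :
    g ≤ ∑ φ ∈ t, |Q φ - e φ| + |Q ψ₀ - e ψ₀| + (a + b) := by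
  have h1 : |Q ψ' - e ψ'| ≤ ∑ φ ∈ t, |Q φ - e φ| :=
    Finset.single_le_sum (f := fun φ => |Q φ - e φ|) (fun _ _ => abs_nonneg _) hψ'
  have h2 := neg_abs_le (Q ψ' - e ψ')
  have h3 := le_abs_self (Q ψ₀ - e ψ₀)
  have h4 := neg_abs_le (Q ψ - Q ψ')
  have h5 := le_abs_self (e ψ - e ψ')
  linarith

end Consistency

end TransformedGP

open TransformedGP
open scoped Matrix.Norms.L2Operator

theorem mainTheorem5 {d q : ℕ} {Ω : Type*} [MeasurableSpace Ω] (P : Measure Ω)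
    [IsProbabilityMeasure P]
    -- the latent Gaussian process, the transformation, the observed field, the locations
    (Z : TransformedGP.Loc d → Ω → ℝ) (kZ : TransformedGP.Loc d → ℝ)
    (hZ : IsGaussianProcess Z P)
    (hZcov : TransformedGP.HasZeroMeanAndCovariance P Z kZ)
    (hkZ : TransformedGP.SubExpAsympPos kZ)
    (T : ℝ → ℝ) (hT : TransformedGP.SubExpNondecreasing T)
    (Y : TransformedGP.Loc d → Ω → ℝ) (hY : ∀ s ω, Y s ω = T (Z s ω))
    (kY : TransformedGP.Loc d → ℝ)
    (hYcov : TransformedGP.HasZeroMeanAndCovariance P Y kY)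
    (x : ℕ → TransformedGP.Loc d) (hx : TransformedGP.WellSeparated x)
    -- the parametric model
    (σinf σsup : ℝ) (hσinf : 0 < σinf) (hσ : σinf < σsup)
    (S : Set (EuclideanSpace ℝ (Fin q))) (hS : IsCompact S)
    (c : EuclideanSpace ℝ (Fin q) → TransformedGP.Loc d → ℝ)
    (hc : ∀ ψ ∈ S, TransformedGP.IsStationaryCorrelationFunction (c ψ))
    (hreg : TransformedGP.HasShortPaths S ∨ ∀ ψ ∈ S, Continuous (c ψ))
    (hsmooth : TransformedGP.SmoothFamily
      (TransformedGP.paramSet (σinf ^ 2) (σsup ^ 2) S) (TransformedGP.covFamily c))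
    (hfourier : TransformedGP.PositiveFourierFamily
      (TransformedGP.paramSet (σinf ^ 2) (σsup ^ 2) S) (TransformedGP.covFamily c))
    -- the model is well specified
    (θ₀ : EuclideanSpace ℝ (Fin (q + 1)))
    (hθ₀ : θ₀ ∈ interior (TransformedGP.paramSet (σinf ^ 2) (σsup ^ 2) S))
    (hkY : kY = TransformedGP.covFamily c θ₀)
    (hident : TransformedGP.GloballyIdentifiable S c x (TransformedGP.corrPart θ₀))
    -- the cross validation estimator: any minimizer of the criterion
    (ψhat : ℕ → Ω → EuclideanSpace ℝ (Fin q))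
    (hψhat : ∀ n : ℕ, 1 ≤ n → ∀ᵐ ω ∂P, ψhat n ω ∈ S ∧
      IsMinOn (fun ψ => TransformedGP.cvCriterion (c ψ) x n (fun i : Fin n => Y (x i) ω)) S
        (ψhat n ω)) :
    TendstoInMeasure P ψhat atTop (fun _ => TransformedGP.corrPart θ₀) := by
  obtain ⟨hT1, -, ⟨C, hC⟩, -⟩ := hT
  have hYZ : Y = fun s ω => T (Z s ω) := funext fun s => funext fun ω => hY s ω
  subst hYZ
  set ψ₀ := corrPart θ₀ with hψ₀def
  have hθ₀' : θ₀ ∈ paramSet (σinf ^ 2) (σsup ^ 2) S := interior_subset hθ₀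
  have hψ₀ : ψ₀ ∈ S := hθ₀'.2
  have h₁ : 0 < σinf ^ 2 := by positivity
  have h₁₂ : σinf ^ 2 ≤ σsup ^ 2 := by gcongr
  set v := θ₀ 0 with hv
  have hv0 : 0 < v := h₁.trans_le hθ₀'.1.1
  obtain ⟨l, M, hl, hM, hwell⟩ := exists_wellConditioned h₁ h₁₂ hS hc hsmooth hfourier hx
  have hK : 0 < (M ^ 2 / l ^ 2) ^ 2 := by positivity
  have hT2 := integrable_sq_gaussianReal hT1.continuous (fun t => (hC t).1) 0 (kZ 0).toNNReal
  have hY2 : ∀ s, MemLp (fun ω => T (Z s ω)) 2 P :=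
    memLp_transformed hZ hZcov hT1.continuous hT2
  have hkY0 : kY 0 = v := by
    rw [hkY]
    change θ₀ 0 * c ψ₀ 0 = v
    rw [(hc ψ₀ hψ₀).2, mul_one]
  have hcovY : ∀ n, covMatrix kY x n = v • covMatrix (c ψ₀) x n := by
    intro n; rw [hkY]; rfl
  set y : (n : ℕ) → Ω → Fin n → ℝ := fun n ω i => T (Z (x i) ω) with hy
  -- `Q n ω ψ` is `n` times the criterion, and `e n ψ` its expectation
  set A : (n : ℕ) → EuclideanSpace ℝ (Fin q) → Matrix (Fin n) (Fin n) ℝ :=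
    fun n ψ => cvMat (covMatrix (c ψ) x n) with hA
  set Q : (n : ℕ) → Ω → EuclideanSpace ℝ (Fin q) → ℝ :=
    fun n ω ψ => y n ω ⬝ᵥ (A n ψ *ᵥ y n ω) with hQ
  set e : (n : ℕ) → EuclideanSpace ℝ (Fin q) → ℝ := fun n ψ => ∫ ω, Q n ω ψ ∂P with he
  have hQint : ∀ n ψ, Integrable (fun ω => Q n ω ψ) P := fun n ψ =>
    (integral_quadForm hYcov hY2 x (A n ψ)).1
  have hetr : ∀ n ψ, e n ψ = v * (A n ψ * covMatrix (c ψ₀) x n).trace := by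
    intro n ψ
    rw [he]
    simp only [hQ, hy]
    rw [(integral_quadForm hYcov hY2 x (A n ψ)).2, hcovY, Matrix.mul_smul, trace_smul,
      smul_eq_mul]
  have hyy : ∀ n, Integrable (fun ω => y n ω ⬝ᵥ y n ω) P ∧ ∫ ω, y n ω ⬝ᵥ y n ω ∂P = n * v := by
    intro n
    have h := integral_dotProduct_self hYcov hY2 x n
    rwa [hkY0] at h
  rw [tendstoInMeasure_iff_norm]
  intro α hα
  rw [ENNReal.tendsto_atTop_zero]
  intro ρ hρ
  obtain ⟨τ, hτ, hgap⟩ := exists_trace_cvMat_gap h₁ h₁₂ hS hc hsmooth hfourier hx hψ₀ hident hα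
  obtain ⟨ε, hε0, hερ⟩ := ENNReal.lt_iff_exists_nnreal_btwn.1 hρ
  have hε : 0 < (ε : ℝ) := by exact_mod_cast hε0
  -- the mesh `ε * τ / 4` contributes `ε * τ / 4 * (n * v)` twice to the expectation of `X` below,
  -- and the concentration bounds contribute `ε * (v * τ) / (2 * m) * n` for each of `m` parameters
  obtain ⟨t, htS, hnet⟩ := exists_finset_norm_cvMat_sub_le h₁ h₁₂ hS hc hreg hsmooth hfourier hx
    (η := ε * τ / 4) (by positivity)
  set m : ℝ := (t.card : ℝ) + 1 with hm
  have hm0 : 0 < m := by positivity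
  obtain ⟨N, hN0, hN⟩ := exists_quadForm_concentration hZ hZcov hkZ.1 hx hT1 hT2 hK
    (ε := ε * (v * τ) / (2 * m)) (by positivity)
  obtain ⟨N', hN'⟩ := eventually_atTop.1 hgap
  refine ⟨max N N', fun n hn => ?_⟩
  have hnN : N ≤ n := (le_max_left _ _).trans hn
  have hn1 : 1 ≤ n := hN0.trans_le hnN
  have hnpos : (0 : ℝ) < n := by exact_mod_cast hn1
  have hdev : ∀ ψ ∈ S, ∫ ω, |Q n ω ψ - e n ψ| ∂P ≤ ε * (v * τ) / (2 * m) * n := fun ψ hψ =>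
    hN n hnN (A n ψ) (cvMat_isSymm (hwell ψ hψ n).symm) ((hwell ψ hψ n).norm_cvMat_le hl hM)
  -- Only the measurability of `X` is needed, not that of `ψhat n`: where the estimator is at distance
  -- at least `α` from `ψ₀`, one has `v * τ * n ≤ X`, while the expectation of `X` is at most
  -- `ε * (v * τ) * n`.
  set X : Ω → ℝ := fun ω => ∑ φ ∈ t, |Q n ω φ - e n φ| + |Q n ω ψ₀ - e n ψ₀| +
    (ε * τ / 4 * (y n ω ⬝ᵥ y n ω) + ε * τ / 4 * (n * v)) with hX
  have hIdev : ∀ ψ, Integrable (fun ω => |Q n ω ψ - e n ψ|) P := fun ψ =>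
    ((hQint n ψ).sub (integrable_const _)).abs
  have hIsum : Integrable (fun ω => ∑ φ ∈ t, |Q n ω φ - e n φ|) P :=
    integrable_finsetSum _ fun φ _ => hIdev φ
  have hI1 : Integrable (fun ω => ∑ φ ∈ t, |Q n ω φ - e n φ| + |Q n ω ψ₀ - e n ψ₀|) P :=
    hIsum.add (hIdev ψ₀)
  have hI2 : Integrable (fun ω => ε * τ / 4 * (y n ω ⬝ᵥ y n ω) + ε * τ / 4 * (n * v)) P :=
    ((hyy n).1.const_mul _).add (integrable_const _)
  have hXI : Integrable X P := hI1.add hI2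
  have hX0 : ∀ ω, 0 ≤ X ω := by
    intro ω
    have := dotProduct_self_nonneg' (y n ω)
    positivity
  have hEX : ∫ ω, X ω ∂P ≤ ε * (v * τ) * n := by
    simp only [hX]
    rw [integral_add hI1 hI2, integral_add hIsum (hIdev ψ₀),
      integral_finsetSum _ fun φ _ => hIdev φ,
      integral_add ((hyy n).1.const_mul _) (integrable_const _), integral_const_mul, (hyy n).2]
    simp only [integral_const, probReal_univ, one_smul]
    have hs : ∑ φ ∈ t, ∫ ω, |Q n ω φ - e n φ| ∂P ≤
        t.card * (ε * (v * τ) / (2 * m) * n) := by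
      rw [← nsmul_eq_mul]
      exact Finset.sum_le_card_nsmul _ _ _ fun φ hφ => hdev φ (htS φ hφ)
    have hs2 := hdev ψ₀ hψ₀
    have hsum : (t.card : ℝ) * (ε * (v * τ) / (2 * m) * n) + ε * (v * τ) / (2 * m) * n
        = ε * (v * τ) / 2 * n := by
      have : (t.card : ℝ) * (ε * (v * τ) / (2 * m) * n) + ε * (v * τ) / (2 * m) * n
        = m * (ε * (v * τ) / (2 * m) * n) := by rw [hm]; ring
      rw [this]; field_simp
    nlinarith
  have hincl : ∀ᵐ ω ∂P, α ≤ ‖ψhat n ω - ψ₀‖ → v * τ * n ≤ X ω := by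
    filter_upwards [hψhat n hn1] with ω hω hα'
    obtain ⟨hmem, hmin⟩ := hω
    obtain ⟨ψ', hψ', hclose⟩ := hnet _ hmem
    have hQle : Q n ω (ψhat n ω) ≤ Q n ω ψ₀ := by
      have h : 1 / (n : ℝ) * Q n ω (ψhat n ω) ≤ 1 / (n : ℝ) * Q n ω ψ₀ := hmin hψ₀
      exact le_of_mul_le_mul_left h (by positivity)
    have hQd : ∀ ω', |Q n ω' (ψhat n ω) - Q n ω' ψ'| ≤ ε * τ / 4 * (y n ω' ⬝ᵥ y n ω') := by
      intro ω'
      have h := abs_dotProduct_mulVec_le (A n (ψhat n ω) - A n ψ') (y n ω')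
      rw [sub_mulVec, dotProduct_sub] at h
      exact h.trans (mul_le_mul_of_nonneg_right (hclose n) (dotProduct_self_nonneg' _))
    refine gap_le_of_net (Q := Q n ω) (e := e n) hψ' ?_ hQle (hQd ω) ?_
    · rw [hetr, hetr, ← mul_sub, mul_assoc]
      exact mul_le_mul_of_nonneg_left
        (hN' n ((le_max_right _ _).trans hn) _ hmem hα') hv0.le
    · rw [he]
      simp only
      rw [← integral_sub (hQint n _) (hQint n _)]
      refine abs_integral_le_integral_abs.trans ?_
      rw [← (hyy n).2, ← integral_const_mul]
      exact integral_mono ((hQint n _).sub (hQint n _)).abs ((hyy n).1.const_mul _) hQd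
  have hmarkov := mul_meas_ge_le_integral_of_nonneg (Eventually.of_forall hX0) hXI (v * τ * n)
  have hreal : P.real {ω | v * τ * n ≤ X ω} ≤ ε := by
    have h := hmarkov.trans hEX
    have hpos : 0 < v * τ * n := by positivity
    refine le_of_mul_le_mul_left (h.trans (le_of_eq ?_)) hpos
    ring
  refine le_trans ?_ hερ.le
  calc P {ω | α ≤ ‖ψhat n ω - ψ₀‖} ≤ P {ω | v * τ * n ≤ X ω} := measure_mono_ae hincl
    _ ≤ ε := by
        rw [← ENNReal.ofReal_toReal (measure_ne_top P {ω | v * τ * n ≤ X ω})]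
        rw [← ENNReal.ofReal_coe_nnreal]
        exact ENNReal.ofReal_le_ofReal hreal
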